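/- Let $E=[-\infty,\infty]\setminus\{0\}$, and let $M_p(E)$ be the space of Radon measures on $E$ with values in $\mathbb Z_+$ on relatively compact Borel sets, equipped with the vague topology and its Borel $\sigma$-algebra. Let $o$ be the null measure, $M_0=M_p(E)\setminus\{o\}$, $[-x,x]^c=\{t\in E:|t|>x\}$, $M_x=\{\mu\in M_0:\mu([-x,x]^c)>0\}$, and let $x_\mu$ be the supremum of the moduli of the atoms of $\mu$ (so $x_o=0$). Let $(\xi_j)_{j\ge1}$ be a strictly stationary sequence of random variables with values in $\mathbb R\setminus\{0\}$, let $a_n>0$ satisfy $nP(|\xi_1|>a_n)\to1$, and suppose that $\xi_1$ has regularly varying tails of order $\alpha>0$: $P(|\xi_1|>x)=x^{-\alpha}L(x)$ for $x>0$ with $L$ slowly varying, $P(\xi_1>x)/P(|\xi_1|>x)\to p$ and $P(\xi_1<-x)/P(|\xi_1|>x)\to 1-p$ as $x\to\infty$, for some $p\in[0,1]$. Let $N_n=\sum_{j=1}^n\delta_{\xi_j/a_n}$, let $(k_n)_n$ be a sequence of nonnegative integers with $k_n\to\infty$, $r_n=\lfloor n/k_n\rfloor$, and, for $1\le i\le k_n$,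 $$N_{i,n}=\sum_{(i-1)r_n<j\le ir_n}\delta_{\xi_j/a_n}.$$ Suppose that $(N_n)_n$ satisfies (AI) with these $N_{i,n}$, that is, $\max_{i\le k_n}P(N_{i,n}(B)>0)\to0$ for every relatively compact Borel set $B\subset E$, and $\bigl|E(e^{-N_n(f)})-\prod_{i=1}^{k_n}E(e^{-N_{i,n}(f)})\bigr|\to0$ for every continuous $f:E\to[0,\infty)$ with compact support. Let $\theta\in(0,1]$ and let $\mathcal Q$ be a probability measure on $\tilde M=\{\mu\in M_p(E):\mu([-1,1]^c)=0,\ \mu(\{-1,1\})>0\}$. On $(0,\infty)$ put $\nu(dy)=\theta\alpha y^{-\alpha-1}dy$, and define $$K(y,M)=\mathcal Q(\pi_y^{-1}(M)\cap\tilde M),\qquad \pi_y\Bigl(\sum_j\delta_{t_j}\Bigr)=\sum_j\delta_{yt_j},\qquad \lambda(M)=\int_0^\infty K(y,M)\,\nu(dy).$$ Then $\lambda$ is a canonical measure, i.e. $\lambda(\{o\})=0$ and $\int(1-e^{-\mu(B)})\lambda(d\mu)<\infty$ for every relatively compact Borel set $B$; for all $x>0$ and all Borel $M\subset M_p(E)$,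 $$\lambda(M_x)=\nu(x,\infty),\qquad \lambda(M\cap M_x)=\int_x^\infty K(y,M)\,\nu(dy);$$ and every infinitely divisible point process $N$ with canonical measure $\lambda$, i.e. with $E(e^{-N(f)})=\exp\{-\int(1-e^{-\mu(f)})\lambda(d\mu)\}$ for all measurable $f:E\to[0,\infty)$, satisfies $N(\{\pm\infty\})=0$ a.s. and has no fixed atoms (no $t\in E$ with $P(N(\{t\})>0)>0$), so that the set $D'=\{x>0: x\text{ or }-x\text{ is a fixed atom of }N\}$ is empty. Moreover, with $Y_{i,n}=x_{N_{i,n}}$ and $\xi_{1,n}=\sum_{j=1}^{r_n}\delta_{\xi_j/\max_{i\le r_n}|\xi_i|}$, the two conditions $$k_nP\bigl(\max_{j\le r_n}|\xi_j|>a_nx\bigr)\to\theta x^{-\alpha}\quad\text{for all }x>0,$$ $$P\bigl(\xi_{1,n}\in\cdot\mid\max_{j\le r_n}|\xi_j|>a_nx\bigr)\xrightarrow{w}\mathcal Q\quad\text{for all }x>0$$ hold together if and only if the following two conditions hold together: (a) $\sum_{i=1}^{k_n}P(Y_{i,n}>x)\to\lambda(M_x)$ for all $x>0$ with $x\notin D'=\emptyset$;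 (b) $\sum_{i=1}^{k_n}P(Y_{i,n}>x,\ N_{i,n}\in M)\to\lambda(M\cap M_x)$ for all $x>0$ with $x\notin D'=\emptyset$ and $\lambda(M_x)>0$, and all Borel sets $M\subset M_0$ with $\lambda(\partial M\cap M_x)=0$. -/

import Mathlib

open Set Filter Topology MeasureTheory ProbabilityTheory
open scoped ENNReal NNReal BoundedContinuousFunction CompactlySupported

noncomputable section

/-! Point measures on a topological space, with the vague topology. -/

/-- The set `M_p(E)` of Radon measures on `E` whose values on relatively compact Borel sets are
nonnegative integers. -/
structure PointMeasure (E : Type*) [TopologicalSpace E] [MeasurableSpace E] where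
  /-- The underlying measure. -/
  toMeasure : Measure E
  /-- Every relatively compact Borel set has a finite integer mass. -/
  integer_valued : ∀ B : Set E, MeasurableSet B → IsCompact (closure B) →
    ∃ m : ℕ, toMeasure B = m

namespace PointMeasure

variable {E : Type*} [TopologicalSpace E] [MeasurableSpace E]

/-- The integral `μ(f)` of a nonnegative function. -/
def integral (μ : PointMeasure E) (f : E → ℝ≥0) : ℝ≥0∞ := ∫⁻ t, (f t : ℝ≥0∞) ∂μ.toMeasure

/-- The vague topology: the coarsest topology for which `μ ↦ μ(f)` is continuous for every
continuous `f : E → [0,∞)` with compact support. -/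
instance : TopologicalSpace (PointMeasure E) :=
  TopologicalSpace.induced (fun (μ : PointMeasure E) (f : C_c(E, ℝ≥0)) => μ.integral f)
    inferInstance

/-- The Borel σ-algebra of the vague topology. -/
instance : MeasurableSpace (PointMeasure E) := borel (PointMeasure E)

instance : BorelSpace (PointMeasure E) := ⟨rfl⟩

/-- The null measure `o`. -/
def null : PointMeasure E := ⟨0, fun _ _ _ => ⟨0, by simp⟩⟩

end PointMeasure

/-- `e^{-t}` for `t ∈ [0,∞]`, with `e^{-∞} = 0`. -/
def expNeg (t : ℝ≥0∞) : ℝ≥0∞ := EReal.exp (-(t : EReal))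

/-- The Laplace functional `E(e^{-N(f)})` of a point process `N`. -/
def laplace {Ω E : Type*} [MeasurableSpace Ω] [TopologicalSpace E] [MeasurableSpace E]
    (P : Measure Ω) (N : Ω → PointMeasure E) (f : E → ℝ≥0) : ℝ≥0∞ :=
  ∫⁻ ω, expNeg ((N ω).integral f) ∂P

/-- Condition (AI) for `(N_n)`, realised by the given array `(N_{i,n})_{1 ≤ i ≤ k_n}`
(written `Nin n i`). -/
def ConditionAI {Ω E : Type*} [MeasurableSpace Ω] [TopologicalSpace E] [MeasurableSpace E]
    (P : Measure Ω) (N : ℕ → Ω → PointMeasure E) (k : ℕ → ℕ)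
    (Nin : ℕ → ℕ → Ω → PointMeasure E) : Prop :=
  Tendsto k atTop atTop ∧
  (∀ B : Set E, MeasurableSet B → IsCompact (closure B) →
    Tendsto (fun n => (Finset.Icc 1 (k n)).sup
      (fun i => P {ω | 0 < (Nin n i ω).toMeasure B})) atTop (𝓝 0)) ∧
  ∀ f : C_c(E, ℝ≥0),
    Tendsto (fun n => |(laplace P (N n) f).toReal
      - ∏ i ∈ Finset.Icc 1 (k n), (laplace P (Nin n i) f).toReal|) atTop (𝓝 0)

/-- `L` is a canonical measure: `L({o}) = 0` and `∫ (1 - e^{-μ(B)}) L(dμ) < ∞` for every relatively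
compact Borel set `B`. -/
def IsCanonicalMeasure {E : Type*} [TopologicalSpace E] [MeasurableSpace E]
    (L : Measure (PointMeasure E)) : Prop :=
  L {PointMeasure.null} = 0 ∧
  ∀ B : Set E, MeasurableSet B → IsCompact (closure B) →
    ∫⁻ μ, (1 - expNeg (μ.toMeasure B)) ∂L < ∞

/-- `R` is the law of an infinitely divisible point process with canonical measure `L`, that is, a
process with Laplace functional `exp(-∫ (1 - e^{-μ(f)}) L(dμ))` for measurable `f : E → [0,∞)`. -/
def IsInfDivLaw {E : Type*} [TopologicalSpace E] [MeasurableSpace E]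
    (R L : Measure (PointMeasure E)) : Prop :=
  IsProbabilityMeasure R ∧ IsCanonicalMeasure L ∧
  ∀ f : E → ℝ≥0, Measurable f →
    laplace R id f = expNeg (∫⁻ μ, (1 - expNeg (μ.integral f)) ∂L)

/-- Weak convergence of measures, tested on bounded continuous functions. -/
def WeaklyConverges {X : Type*} [TopologicalSpace X] [MeasurableSpace X]
    (Q' : ℕ → Measure X) (Q : Measure X) : Prop :=
  ∀ h : X →ᵇ ℝ, Tendsto (fun n => ∫ x, h x ∂(Q' n)) atTop (𝓝 (∫ x, h x ∂Q))

/-! The space `E = [-∞,∞] \ {0}`. -/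

/-- The space `[-∞,∞] \ {0}`, with the subspace topology and its Borel σ-algebra. -/
abbrev PuncturedEReal : Type := {t : EReal // t ≠ 0}

/-- The set `[-x,x]^c = {t ∈ E : |t| > x}`. -/
def outside (x : ℝ) : Set PuncturedEReal := {t | ENNReal.ofReal x < (t : EReal).abs}

/-- Point measures on `[-∞,∞] \ {0}`. -/
abbrev PM : Type := PointMeasure PuncturedEReal

/-- `x_μ`, the supremum of the moduli of the atoms of `μ`. It is infinite only if `±∞` is
an atom; it is `0` for the null measure. -/
def topModulus (μ : PM) : ℝ≥0∞ :=
  ⨆ (t : PuncturedEReal) (_ : 0 < μ.toMeasure {t}), (t : EReal).abs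

/-- `M_0`, the set of nonzero point measures. -/
def M₀ : Set PM := {μ | μ ≠ PointMeasure.null}

/-- `M_x`, the set of nonzero point measures that charge `[-x,x]^c`. -/
def MSet (x : ℝ) : Set PM := {μ | μ ∈ M₀ ∧ 0 < μ.toMeasure (outside x)}

/-- `M̃`, the set of point measures that do not charge `[-1,1]^c` but charge `{-1,1}`. -/
def MTilde : Set PM :=
  {μ | μ.toMeasure (outside 1) = 0 ∧ 0 < μ.toMeasure {t | (t : EReal) = -1 ∨ (t : EReal) = 1}}

/-- The point measure `∑_{j ∈ s} δ_{x_j}` of the nonzero real numbers `x_j` (a point at `0`, which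
is not in the space, would not be counted). -/
def pointSum (s : Finset ℕ) (x : ℕ → ℝ) : PM where
  toMeasure := ∑ j ∈ s, (Measure.dirac (x j : EReal)).comap Subtype.val
  integer_valued := by
    classical
    intro B hB _
    have hE : MeasurableSet {t : EReal | t ≠ 0} := (measurableSet_singleton (0 : EReal)).compl
    refine ⟨∑ j ∈ s, if (x j : EReal) ∈ (Subtype.val '' B : Set EReal) then 1 else 0, ?_⟩
    rw [Measure.finsetSum_apply]
    push_cast
    refine Finset.sum_congr rfl fun j _ => ?_
    have he : MeasurableEmbedding (Subtype.val : PuncturedEReal → EReal) :=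
      MeasurableEmbedding.subtype_coe hE
    rw [he.comap_apply, Measure.dirac_apply' _ (he.measurableSet_image.2 hB)]
    simp [Set.indicator]

/-- The map `t ↦ y t` on `[-∞,∞] \ {0}`, for `y > 0`. -/
def dilate (y : Ioi (0 : ℝ)) (t : PuncturedEReal) : PuncturedEReal :=
  ⟨((y : ℝ) : EReal) * t,
    mul_ne_zero (by exact_mod_cast (ne_of_gt (mem_Ioi.1 y.2))) t.2⟩

theorem continuous_dilate (y : Ioi (0 : ℝ)) : Continuous (dilate y) := by
  refine Continuous.subtype_mk ?_ _
  have hy : ((y : ℝ) : EReal) ≠ 0 := by exact_mod_cast (ne_of_gt (mem_Ioi.1 y.2))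
  have h : Continuous fun t : EReal => ((y : ℝ) : EReal) * t := by
    refine continuous_iff_continuousAt.2 fun t => ?_
    have := EReal.continuousAt_mul (p := (((y : ℝ) : EReal), t)) (Or.inl hy) (Or.inl hy)
      (Or.inl (EReal.coe_ne_bot _)) (Or.inl (EReal.coe_ne_top _))
    exact ContinuousAt.comp (f := fun t : EReal => (((y : ℝ) : EReal), t)) this
      (by fun_prop)
  exact h.comp continuous_subtype_val

theorem dilate_inv (y z : Ioi (0 : ℝ)) (h : (y : ℝ) * z = 1) (t : PuncturedEReal) :
    dilate y (dilate z t) = t := by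
  apply Subtype.ext
  simp only [dilate]
  rw [← mul_assoc, ← EReal.coe_mul, h, EReal.coe_one, one_mul]

/-- `π_y(∑ δ_{t_j}) = ∑ δ_{y t_j}`. -/
def scale (y : Ioi (0 : ℝ)) (μ : PM) : PM where
  toMeasure := μ.toMeasure.map (dilate y)
  integer_valued := by
    intro B hB hc
    rw [Measure.map_apply (continuous_dilate y).measurable hB]
    refine μ.integer_valued _ ((continuous_dilate y).measurable hB) ?_
    have hy : (0 : ℝ) < y := y.2
    let z : Ioi (0 : ℝ) := ⟨(y : ℝ)⁻¹, inv_pos.2 hy⟩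
    have h1 : (z : ℝ) * y = 1 := inv_mul_cancel₀ hy.ne'
    refine (hc.image (continuous_dilate z)).closure_of_subset ?_
    intro t ht
    exact ⟨dilate y t, subset_closure ht, dilate_inv z y h1 t⟩

/-! Stationary regularly varying sequences, indexed by `j ≥ 1`. -/

section Sequence

variable {Ω : Type*} [MeasurableSpace Ω]

/-- Strict stationarity of `(ξ_j)_{j ≥ 1}`. -/
def IsStationarySeq (P : Measure Ω) (ξ : ℕ → Ω → ℝ) : Prop :=
  ∀ h : ℕ, P.map (fun ω (j : ℕ) => ξ (j + 1 + h) ω) = P.map (fun ω (j : ℕ) => ξ (j + 1) ω)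

/-- Slow variation at infinity. -/
def SlowlyVarying (L : ℝ → ℝ) : Prop :=
  (∀ᶠ x in atTop, 0 < L x) ∧ ∀ c : ℝ, 0 < c → Tendsto (fun x => L (c * x) / L x) atTop (𝓝 1)

/-- `X` has regularly varying tail probabilities of order `α`. -/
def RegularlyVaryingTails (P : Measure Ω) (X : Ω → ℝ) (α : ℝ) : Prop :=
  (∃ L : ℝ → ℝ, SlowlyVarying L ∧ ∀ x : ℝ, 0 < x → P.real {ω | x < |X ω|} = x ^ (-α) * L x) ∧
  ∃ p q : ℝ, 0 ≤ p ∧ p ≤ 1 ∧ q = 1 - p ∧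
    Tendsto (fun x => P.real {ω | x < X ω} / P.real {ω | x < |X ω|}) atTop (𝓝 p) ∧
    Tendsto (fun x => P.real {ω | X ω < -x} / P.real {ω | x < |X ω|}) atTop (𝓝 q)

/-- `N_n = ∑_{j=1}^n δ_{ξ_j / a_n}`. -/
def processN (ξ : ℕ → Ω → ℝ) (a : ℕ → ℝ) (n : ℕ) (ω : Ω) : PM :=
  pointSum (Finset.Icc 1 n) (fun j => ξ j ω / a n)

/-- The block length `r_n = ⌊n / k_n⌋`. -/
def blockLength (k : ℕ → ℕ) (n : ℕ) : ℕ := n / k n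

/-- `N_{i,n} = ∑_{j ∈ J_{i,n}} δ_{ξ_j / a_n}`, with `J_{i,n} = ((i-1) r_n, i r_n]` for `i ≥ 1`. -/
def blockN (ξ : ℕ → Ω → ℝ) (a : ℕ → ℝ) (k : ℕ → ℕ) (n i : ℕ) (ω : Ω) : PM :=
  pointSum (Finset.Ioc ((i - 1) * blockLength k n) (i * blockLength k n)) (fun j => ξ j ω / a n)

/-- `max_{1 ≤ j ≤ r} |ξ_j|`. -/
def maxAbs (ξ : ℕ → Ω → ℝ) (r : ℕ) (ω : Ω) : ℝ :=
  ((Finset.Icc 1 r).sup (fun j => ‖ξ j ω‖₊) : ℝ≥0)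

/-- The normalized cluster `ξ_{1,n} = ∑_{j=1}^{r_n} δ_{ξ_j / max_{i ≤ r_n} |ξ_i|}`. -/
def cluster (ξ : ℕ → Ω → ℝ) (k : ℕ → ℕ) (n : ℕ) (ω : Ω) : PM :=
  pointSum (Finset.Icc 1 (blockLength k n)) (fun j => ξ j ω / maxAbs ξ (blockLength k n) ω)

/-- `k_n P(max_{j ≤ r_n} |ξ_j| > a_n x) → θ x^{-α}` for all `x > 0`. -/
def MaximaCondition (P : Measure Ω) (ξ : ℕ → Ω → ℝ) (a : ℕ → ℝ) (k : ℕ → ℕ) (θ α : ℝ) : Prop :=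
  ∀ x : ℝ, 0 < x →
    Tendsto (fun n => (k n : ℝ) * P.real {ω | a n * x < maxAbs ξ (blockLength k n) ω})
      atTop (𝓝 (θ * x ^ (-α)))

/-- `P(ξ_{1,n} ∈ · | max_{j ≤ r_n} |ξ_j| > a_n x)` converges weakly to `Q`, for all `x > 0`. -/
def ClusterCondition (P : Measure Ω) (ξ : ℕ → Ω → ℝ) (a : ℕ → ℝ) (k : ℕ → ℕ)
    (Q : Measure PM) : Prop :=
  ∀ x : ℝ, 0 < x →
    WeaklyConverges
      (fun n => (P[|{ω | a n * x < maxAbs ξ (blockLength k n) ω}]).map (cluster ξ k n)) Q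

/-- Condition (a) for the array `(N_{i,n})_{1 ≤ i ≤ k_n}`, the canonical measure `L` and the
exceptional set `D'`; here `Y_{i,n} = x_{N_{i,n}}`. -/
def ConditionA (P : Measure Ω) (k : ℕ → ℕ) (Nin : ℕ → ℕ → Ω → PM) (L : Measure PM)
    (D' : Set ℝ) : Prop :=
  ∀ x : ℝ, 0 < x → x ∉ D' →
    Tendsto (fun n => ∑ i ∈ Finset.Icc 1 (k n),
      P {ω | ENNReal.ofReal x < topModulus (Nin n i ω)}) atTop (𝓝 (L (MSet x)))

/-- Condition (b), with the same data. -/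
def ConditionB (P : Measure Ω) (k : ℕ → ℕ) (Nin : ℕ → ℕ → Ω → PM) (L : Measure PM)
    (D' : Set ℝ) : Prop :=
  ∀ x : ℝ, 0 < x → x ∉ D' → 0 < L (MSet x) →
    ∀ M : Set PM, MeasurableSet M → M ⊆ M₀ → L (frontier M ∩ MSet x) = 0 →
      Tendsto (fun n => ∑ i ∈ Finset.Icc 1 (k n),
        P {ω | ENNReal.ofReal x < topModulus (Nin n i ω) ∧ Nin n i ω ∈ M})
        atTop (𝓝 (L (M ∩ MSet x)))

end Sequence

/-- `D' = {x > 0 : x ∈ D or -x ∈ D}`, where `D` is the set of fixed atoms of a point process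
with law `R`. -/
def fixedAtomModuli (R : Measure PM) : Set ℝ :=
  {x | 0 < x ∧ ∃ t : PuncturedEReal, ((t : EReal) = (x : EReal) ∨ (t : EReal) = ((-x : ℝ) : EReal)) ∧
    0 < R {μ | 0 < μ.toMeasure {t}}}

/-- The measure `ν(dy) = θ α y^{-α-1} dy` on `(0,∞)`. -/
def nuMeasure (θ α : ℝ) : Measure (Ioi (0 : ℝ)) :=
  ((volume : Measure ℝ).comap Subtype.val).withDensity (fun y => ENNReal.ofReal (θ * α * (y : ℝ) ^ (-α - 1)))

/-- The kernel `K(y, M) = Q(π_y⁻¹(M) ∩ M̃)`. -/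
def kernelK (Q : Measure PM) (y : Ioi (0 : ℝ)) : Measure PM := (Q.restrict MTilde).map (scale y)

/-- The measure `λ(M) = ∫_0^∞ K(y, M) ν(dy)`. -/
def lambdaMeasure (θ α : ℝ) (Q : Measure PM) : Measure PM := (nuMeasure θ α).bind (kernelK Q)

end

/-! The equivalence is a change to polar coordinates. A nonzero point measure without mass at
infinity is determined by its largest modulus (`radius`) and by its rescaling to largest modulus one
(`normalise`); `scale` reassembles the two, and `λ` is the image of the product of `ν` and `Q` under
`scale`. By stationarity all blocks have the law `m_n` of the first one, so the sums in (a) and (b)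
are `k_n` times a value of `m_n`, and the cluster is the normalised first block. Condition (a) then
is the maxima condition. Under it, the cluster condition says that `k_n m_n`, restricted to `M_x`
and read in polar coordinates, converges on product sets (`JointConverges`), while (b) says that it
converges on `λ`-continuity sets (`SetsConverge`).

From products to sets: boxes `(a, b] × V`, with `V` a `Q`-continuity set, form a π-system that
determines weak convergence, and `scale` is jointly continuous, so the continuous mapping theorem
applies (`JointConverges.setsConverge`). From sets to products: `normalise` is continuous where the
largest modulus is finite and positive, so pulling back a `Q`-continuity set yields an admissible
set in (b) (`SetsConverge.jointConverges`).

The topological input is that the vague topology is second countable and pseudo-metrizable, and that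
the largest modulus is continuous (`continuous_topModulus`), which rests on integer masses and on
the compactness of `{|t| ≥ c}` in a space containing `±∞`. Fixed atoms are excluded by Fubini, as
`ν` charges no countable set. -/

noncomputable section

/-! ### Compactly supported test functions. -/

section TestFunctions

variable {E : Type*} [TopologicalSpace E] [T2Space E] [LocallyCompactSpace E]

theorem exists_compactlySupported_eq_one {K : Set E} (hK : IsCompact K) {U : Set E} (hU : IsOpen U)
    (hKU : K ⊆ U) : ∃ h : C_c(E, ℝ≥0), (∀ t ∈ K, h t = 1) ∧ (∀ t, h t ≤ 1) ∧ ∀ t ∉ U, h t = 0 := by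
  obtain ⟨f, h1, h2, h3, h4⟩ := exists_continuousMap_one_of_isCompact_subset_isOpen hK hU hKU
  refine ⟨⟨⟨fun t => (f t).toNNReal, by fun_prop⟩, ?_⟩, ?_, ?_, ?_⟩
  · exact HasCompactSupport.comp_left (f := f) (g := Real.toNNReal) h2 (by simp)
  · intro t ht
    show (f t).toNNReal = 1
    simp [h1 ht]
  · intro t
    show (f t).toNNReal ≤ 1
    simpa using (h4 t).2
  · intro t ht
    show (f t).toNNReal = 0
    rw [image_eq_zero_of_notMem_tsupport (fun h => ht (h3 h))]; simp

/-- A countable family of test functions approximating all the others. -/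
theorem exists_countable_approximating [SecondCountableTopology E] : ∃ D : Set C_c(E, ℝ≥0), D.Countable ∧
    ∀ f : C_c(E, ℝ≥0), ∃ h ∈ D, ∀ δ : ℝ≥0, 0 < δ → ∃ d ∈ D,
      ∀ t, f t ≤ d t + δ * h t ∧ d t ≤ f t + δ * h t := by
  let K := CompactExhaustion.choice E
  choose h h1 h2 h3 using fun m : ℕ =>
    exists_compactlySupported_eq_one (K.isCompact m) isOpen_univ (subset_univ (K m))
  obtain ⟨S, hSc, hSd⟩ := TopologicalSpace.exists_countable_dense C(E, ℝ≥0)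
  -- Cutting a countable dense family of `C(E, ℝ≥0)` off by `h m` keeps it countable and gives
  -- compact support. The cutoff is one on the support of `f` for large `m`, so the error is a
  -- multiple of `h m` itself.
  let F : ℕ → C(E, ℝ≥0) → C_c(E, ℝ≥0) := fun m g =>
    ⟨(h m).toContinuousMap * g, HasCompactSupport.mul_right (h m).hasCompactSupport⟩
  refine ⟨(range h) ∪ ⋃ m, F m '' S, ?_, ?_⟩
  · exact (countable_range h).union (countable_iUnion fun m => hSc.image _)
  intro f
  obtain ⟨m, hm⟩ := K.exists_superset_of_isCompact (s := tsupport f) f.hasCompactSupport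
  refine ⟨h m, Or.inl ⟨m, rfl⟩, fun δ hδ => ?_⟩
  have hnear : ∃ g ∈ S, ∀ t ∈ tsupport (h m), dist (f t) (g t) < δ := by
    have hT := (ContinuousMap.tendsto_iff_forall_isCompact_tendstoUniformlyOn
      (F := fun g : C(E, ℝ≥0) => g) (p := 𝓝 f.toContinuousMap) (f := f.toContinuousMap)).1
      tendsto_id (tsupport (h m)) (h m).hasCompactSupport
    have := Metric.tendstoUniformlyOn_iff.1 hT δ hδ
    obtain ⟨g, hg, hgS⟩ := ((mem_closure_iff_frequently.1 (hSd f.toContinuousMap)).and_eventually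
      this).exists
    exact ⟨g, hg, hgS⟩
  obtain ⟨g, hgS, hg⟩ := hnear
  refine ⟨F m g, Or.inr (mem_iUnion.2 ⟨m, g, hgS, rfl⟩), fun t => ?_⟩
  have hF : F m g t = h m t * g t := rfl
  have hf : f t = h m t * f t := by
    by_cases ht : t ∈ tsupport f
    · rw [h1 m t (hm ht), one_mul]
    · simp [image_eq_zero_of_notMem_tsupport ht]
  rw [hF, hf]
  by_cases ht : t ∈ tsupport (h m)
  · have hd := hg t ht
    rw [NNReal.dist_eq, abs_lt] at hd
    have h4 : f t ≤ g t + δ := by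
      rw [← NNReal.coe_le_coe]; push_cast; linarith [hd.2]
    have h5 : g t ≤ f t + δ := by
      rw [← NNReal.coe_le_coe]; push_cast; linarith [hd.1]
    constructor
    · calc h m t * f t ≤ h m t * (g t + δ) := by gcongr
        _ = _ := by ring
    · calc h m t * g t ≤ h m t * (f t + δ) := by gcongr
        _ = _ := by ring
  · simp [image_eq_zero_of_notMem_tsupport ht]

end TestFunctions

/-- An extended nonnegative function that is approximated near `y₀` by functions continuous at `y₀`,
with an error that is a small multiple of a locally bounded function, is continuous at `y₀`. -/
theorem continuousAt_of_approximating {Y : Type*} [TopologicalSpace Y] {u H : Y → ℝ≥0∞} {y₀ : Y}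
    (hu : u y₀ ≠ ∞) (hH : H y₀ ≠ ∞) (hHc : ContinuousAt H y₀)
    (h : ∀ δ : ℝ≥0, 0 < δ → ∃ d : Y → ℝ≥0∞, d y₀ ≠ ∞ ∧ ContinuousAt d y₀ ∧
      ∀ᶠ y in 𝓝 y₀, u y ≤ d y + δ * H y ∧ d y ≤ u y + δ * H y) : ContinuousAt u y₀ := by
  refine (ENNReal.tendsto_nhds hu).2 fun ε hε => ?_
  obtain ⟨ε', hε', hεε'⟩ := ENNReal.lt_iff_exists_nnreal_btwn.1 hε
  have hε'0 : (0 : ℝ≥0) < ε' := by exact_mod_cast hε'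
  lift H y₀ to ℝ≥0 using hH with H₀ hHe
  -- Near `y₀` one has `H < H₀ + 1`, so the error `δ * H` is at most `ε' / 3`. It is paid once at
  -- `y` and once at `y₀`; the last third is the variation of `d`.
  let δ : ℝ≥0 := ε' / 3 / (H₀ + 1)
  have hδ : 0 < δ := by positivity
  have hδH : δ * (H₀ + 1) = ε' / 3 := div_mul_cancel₀ _ (by positivity)
  obtain ⟨d, hd0, hdc, hd⟩ := h δ hδ
  have e1 : ∀ᶠ y in 𝓝 y₀, H y < (H₀ + 1 : ℝ≥0) := by
    refine hHc.eventually_lt continuousAt_const ?_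
    rw [← hHe]
    exact_mod_cast lt_add_one H₀
  have e2 := (ENNReal.tendsto_nhds hd0).1 hdc (ε' / 3 : ℝ≥0)
    (by exact_mod_cast (by positivity : 0 < ε' / 3))
  have hsum : ((ε' / 3 : ℝ≥0) : ℝ≥0∞) + (ε' / 3 : ℝ≥0) + (ε' / 3 : ℝ≥0) = ε' := by
    rw [← ENNReal.coe_add, ← ENNReal.coe_add]; congr 1; ring
  have hd' : ∀ᶠ y in 𝓝 y₀, u y ≤ d y + (ε' / 3 : ℝ≥0) ∧ d y ≤ u y + (ε' / 3 : ℝ≥0) := by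
    filter_upwards [hd, e1] with y hy hy1
    have : (δ : ℝ≥0∞) * H y ≤ (ε' / 3 : ℝ≥0) := by
      calc (δ : ℝ≥0∞) * H y ≤ δ * (H₀ + 1 : ℝ≥0) := by gcongr
        _ = (ε' / 3 : ℝ≥0) := by rw [← ENNReal.coe_mul, hδH]
    exact ⟨hy.1.trans (by gcongr), hy.2.trans (by gcongr)⟩
  have k0 := hd'.self_of_nhds
  filter_upwards [hd', e2] with y hy hy2
  rw [mem_Icc, tsub_le_iff_right] at hy2
  rw [mem_Icc, tsub_le_iff_right]
  constructor
  · calc u y₀ ≤ d y₀ + (ε' / 3 : ℝ≥0) := k0.1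
      _ ≤ (d y + (ε' / 3 : ℝ≥0)) + (ε' / 3 : ℝ≥0) := by gcongr; exact hy2.1
      _ ≤ ((u y + (ε' / 3 : ℝ≥0)) + (ε' / 3 : ℝ≥0)) + (ε' / 3 : ℝ≥0) := by gcongr; exact hy.2
      _ = u y + ε' := by rw [← hsum]; ring
      _ ≤ u y + ε := by gcongr
  · calc u y ≤ d y + (ε' / 3 : ℝ≥0) := hy.1
      _ ≤ (d y₀ + (ε' / 3 : ℝ≥0)) + (ε' / 3 : ℝ≥0) := by gcongr; exact hy2.2
      _ ≤ ((u y₀ + (ε' / 3 : ℝ≥0)) + (ε' / 3 : ℝ≥0)) + (ε' / 3 : ℝ≥0) := by gcongr; exact k0.2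
      _ = u y₀ + ε' := by rw [← hsum]; ring
      _ ≤ u y₀ + ε := by gcongr

/-! ### Point measures: topology, measurability, atoms. -/

namespace PointMeasure

variable {E : Type*} [TopologicalSpace E] [MeasurableSpace E]

theorem continuous_integral (f : C_c(E, ℝ≥0)) :
    Continuous fun μ : PointMeasure E => μ.integral f :=
  continuous_pi_iff.1 (continuous_induced_dom
    (f := fun (μ : PointMeasure E) (f : C_c(E, ℝ≥0)) => μ.integral f)) f

theorem ext_toMeasure {μ ν : PointMeasure E} (h : μ.toMeasure = ν.toMeasure) : μ = ν := by
  cases μ; cases ν; cases h; rfl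

theorem continuous_of_integral {Y : Type*} [TopologicalSpace Y] {Φ : Y → PointMeasure E}
    (h : ∀ f : C_c(E, ℝ≥0), Continuous fun y => (Φ y).integral f) : Continuous Φ :=
  continuous_induced_rng.2 (continuous_pi h)

/-- On relatively compact sets, mass below one means no mass. -/
theorem measure_eq_zero_of_lt_one (μ : PointMeasure E) {B : Set E} (hB : MeasurableSet B)
    (hc : IsCompact (closure B)) (h : μ.toMeasure B < 1) : μ.toMeasure B = 0 := by
  obtain ⟨m, hm⟩ := μ.integer_valued B hB hc
  rw [hm] at h ⊢
  have : m < 1 := by exact_mod_cast h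
  simp [Nat.lt_one_iff.1 this]

theorem integral_le_add_mul [OpensMeasurableSpace E] (μ : PointMeasure E) {f g h : C_c(E, ℝ≥0)} {δ : ℝ≥0}
    (H : ∀ t, f t ≤ g t + δ * h t) : μ.integral f ≤ μ.integral g + δ * μ.integral h := by
  have hg : Measurable fun t => (g t : ℝ≥0∞) := (ENNReal.continuous_coe.comp g.continuous).measurable
  have hh : Measurable fun t => (h t : ℝ≥0∞) := (ENNReal.continuous_coe.comp h.continuous).measurable
  unfold integral
  rw [← lintegral_const_mul _ hh, ← lintegral_add_left hg]
  exact lintegral_mono fun t => by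
    rw [← ENNReal.coe_mul, ← ENNReal.coe_add]
    exact ENNReal.coe_le_coe.2 (H t)

section Compact

variable [T2Space E] [BorelSpace E]

theorem measure_lt_top_of_isCompact (μ : PointMeasure E) {K : Set E} (hK : IsCompact K) :
    μ.toMeasure K < ∞ := by
  obtain ⟨m, hm⟩ := μ.integer_valued K hK.measurableSet (by rwa [hK.isClosed.closure_eq])
  simp [hm]

instance (μ : PointMeasure E) : IsFiniteMeasureOnCompacts μ.toMeasure :=
  ⟨fun _ hK => μ.measure_lt_top_of_isCompact hK⟩

theorem integral_lt_top (μ : PointMeasure E) (f : C_c(E, ℝ≥0)) : μ.integral f < ∞ := by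
  obtain ⟨C, hC⟩ := (f.hasCompactSupport.comp_left (g := ((↑) : ℝ≥0 → ℝ)) rfl).exists_bound_of_continuous
    (NNReal.continuous_coe.comp f.continuous)
  have hle : ∀ t, (f t : ℝ≥0∞) ≤ (tsupport f).indicator (fun _ => ENNReal.ofReal C) t := by
    intro t
    by_cases ht : t ∈ tsupport f
    · rw [indicator_of_mem ht]
      have := hC t
      simp only [Function.comp_apply, Real.norm_eq_abs, NNReal.abs_eq] at this
      rw [← ENNReal.ofReal_coe_nnreal]
      exact ENNReal.ofReal_le_ofReal this
    · rw [indicator_of_notMem ht, image_eq_zero_of_notMem_tsupport ht]; simp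
  have hK : IsCompact (tsupport f) := f.hasCompactSupport
  calc μ.integral f ≤ ∫⁻ t, (tsupport f).indicator (fun _ => ENNReal.ofReal C) t ∂μ.toMeasure :=
        lintegral_mono hle
    _ = ENNReal.ofReal C * μ.toMeasure (tsupport f) := by
        rw [lintegral_indicator hK.measurableSet, setLIntegral_const]
    _ < ∞ := ENNReal.mul_lt_top ENNReal.ofReal_lt_top (μ.measure_lt_top_of_isCompact hK)

/-- The error functions `h` lie in `D` too, so their integrals are continuous, hence locally
bounded, and `continuousAt_of_approximating` applies. -/
theorem continuous_integral_of_approximating {D : Set C_c(E, ℝ≥0)}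
    (hD : ∀ f : C_c(E, ℝ≥0), ∃ h ∈ D, ∀ δ : ℝ≥0, 0 < δ → ∃ d ∈ D,
      ∀ t, f t ≤ d t + δ * h t ∧ d t ≤ f t + δ * h t)
    {Y : Type*} [TopologicalSpace Y] {Φ : Y → PointMeasure E}
    (hΦ : ∀ d ∈ D, Continuous fun y => (Φ y).integral d) (f : C_c(E, ℝ≥0)) :
    Continuous fun y => (Φ y).integral f := by
  obtain ⟨h, hh, hf⟩ := hD f
  refine continuous_iff_continuousAt.2 fun y₀ => ?_
  refine continuousAt_of_approximating (integral_lt_top _ f).ne (integral_lt_top _ h).ne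
    (hΦ h hh).continuousAt fun δ hδ => ?_
  obtain ⟨d, hdD, hd⟩ := hf δ hδ
  exact ⟨_, (integral_lt_top _ d).ne, (hΦ d hdD).continuousAt, Eventually.of_forall fun y =>
    ⟨integral_le_add_mul _ fun t => (hd t).1, integral_le_add_mul _ fun t => (hd t).2⟩⟩

variable [LocallyCompactSpace E] [SecondCountableTopology E]

/-- Countably many test functions induce the vague topology. -/
theorem exists_countable_isInducing : ∃ D : Set C_c(E, ℝ≥0), D.Countable ∧
    IsInducing fun (μ : PointMeasure E) (d : D) => μ.integral d := by
  obtain ⟨D, hDc, hD⟩ := exists_countable_approximating (E := E)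
  refine ⟨D, hDc, ⟨le_antisymm ?_ ?_⟩⟩
  · exact continuous_iff_le_induced.1 (continuous_pi fun d => continuous_integral _)
  · refine continuous_iff_le_induced.1 ?_
    -- The a priori coarser topology given by `D` alone; the identity out of it is shown to be
    -- continuous into the vague topology.
    let τ : TopologicalSpace (PointMeasure E) := TopologicalSpace.induced
      (fun (μ : PointMeasure E) (d : D) => μ.integral d) inferInstance
    refine @continuous_pi _ _ _ τ _ _ fun f => ?_
    refine @continuous_integral_of_approximating E _ _ _ _ D hD (PointMeasure E) τ id ?_ f
    intro d hd
    exact continuous_pi_iff.1 (continuous_induced_dom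
      (f := fun (μ : PointMeasure E) (d : D) => μ.integral d)) ⟨d, hd⟩

instance : SecondCountableTopology (PointMeasure E) := by
  obtain ⟨D, hDc, hD⟩ := exists_countable_isInducing (E := E)
  have := hDc.to_subtype
  exact hD.secondCountableTopology

/-- This gives access to the portmanteau theorem and to balls with null frontier; second
countability makes Borel sets of products with `PM` product measurable. -/
instance : TopologicalSpace.PseudoMetrizableSpace (PointMeasure E) := by
  obtain ⟨D, hDc, hD⟩ := exists_countable_isInducing (E := E)
  have := hDc.to_subtype
  exact hD.pseudoMetrizableSpace

theorem measurable_of_integral {Y : Type*} [MeasurableSpace Y] {Φ : Y → PointMeasure E}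
    (h : ∀ f : C_c(E, ℝ≥0), Measurable fun y => (Φ y).integral f) : Measurable Φ := by
  obtain ⟨D, hDc, hD⟩ := exists_countable_isInducing (E := E)
  have := hDc.to_subtype
  refine measurable_of_isOpen fun U hU => ?_
  obtain ⟨V, hV, rfl⟩ := hD.isOpen_iff.1 hU
  have hm : Measurable fun y (d : D) => (Φ y).integral d := measurable_pi_iff.2 fun d => h d
  exact hm hV.measurableSet

/-- The indicator of `K` is a pointwise limit of continuous functions. Multiplication by the cutoff
`h` makes them test functions and provides an integrable bound. -/
theorem measurable_measure_of_isCompact {K : Set E} (hK : IsCompact K) :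
    Measurable fun μ : PointMeasure E => μ.toMeasure K := by
  obtain ⟨h, h1, h2, -⟩ := exists_compactlySupported_eq_one hK isOpen_univ (subset_univ K)
  let g := hK.isClosed.apprSeq
  let F : ℕ → C_c(E, ℝ≥0) := fun n =>
    ⟨h.toContinuousMap * (g n).toContinuousMap, HasCompactSupport.mul_right h.hasCompactSupport⟩
  have hF : ∀ n t, F n t = h t * g n t := fun n t => rfl
  refine measurable_of_tendsto_metrizable (fun n => (continuous_integral (F n)).measurable)
    (tendsto_pi_nhds.2 fun μ => ?_)
  rw [← lintegral_indicator_one hK.measurableSet]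
  unfold integral
  refine tendsto_lintegral_of_dominated_convergence (fun t => (h t : ℝ≥0∞)) ?_ ?_ ?_ ?_
  · exact fun n => (ENNReal.continuous_coe.comp (F n).continuous).measurable
  · refine fun n => ae_of_all _ fun t => ?_
    refine ENNReal.coe_le_coe.2 ?_
    rw [hF]
    exact mul_le_of_le_one_right' (HasOuterApproxClosed.apprSeq_apply_le_one _ n t)
  · exact (integral_lt_top μ h).ne
  · refine ae_of_all _ fun t => ?_
    have h3 := tendsto_pi_nhds.1 (HasOuterApproxClosed.tendsto_apprSeq hK.isClosed) t
    have h4 : Tendsto (fun n => F n t) atTop (𝓝 (h t * K.indicator (fun _ => 1) t)) := by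
      simp only [hF]; exact h3.const_mul _
    have h5 : ((h t * K.indicator (fun _ => 1) t : ℝ≥0) : ℝ≥0∞) = K.indicator 1 t := by
      by_cases ht : t ∈ K
      · simp [ht, h1 t ht]
      · simp [ht]
    rw [← h5]
    exact ENNReal.tendsto_coe.2 h4

/-- A compact null set has an open neighbourhood of mass zero. -/
theorem exists_isOpen_measure_eq_zero (μ : PointMeasure E) {K : Set E} (hK : IsCompact K)
    (h : μ.toMeasure K = 0) : ∃ U, IsOpen U ∧ K ⊆ U ∧ μ.toMeasure U = 0 := by
  obtain ⟨U, hKU, hU, hU1⟩ := K.exists_isOpen_lt_of_lt (μ := μ.toMeasure) 1 (by simp [h])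
  -- Integrality holds only on relatively compact sets, so `U` is shrunk before mass below one is
  -- turned into mass zero.
  obtain ⟨V, hV, hKV, hVU, hVc⟩ := exists_open_between_and_isCompact_closure hK hU hKU
  refine ⟨V, hV, hKV, μ.measure_eq_zero_of_lt_one hV.measurableSet hVc ?_⟩
  exact (measure_mono (subset_closure.trans hVU)).trans_lt hU1

/-- A point that is not an atom has a null neighbourhood, and by second countability a locally null
set is null. -/
theorem exists_atom (μ : PointMeasure E) {B : Set E} (h : 0 < μ.toMeasure B) :
    ∃ t ∈ B, 0 < μ.toMeasure {t} := by
  by_contra! hc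
  refine h.ne' (measure_null_of_locally_null B fun t ht => ?_)
  obtain ⟨U, hU, htU, hU0⟩ := μ.exists_isOpen_measure_eq_zero isCompact_singleton
    (nonpos_iff_eq_zero.1 (hc t ht))
  exact ⟨U, mem_nhdsWithin_of_mem_nhds (hU.mem_nhds (htU rfl)), hU0⟩

/-- A bump function at an atom in `U`, supported in `U`, has positive integral; this is an open
condition that forces mass in `U`. -/
theorem isOpen_setOf_measure_pos {U : Set E} (hU : IsOpen U) :
    IsOpen {μ : PointMeasure E | 0 < μ.toMeasure U} := by
  refine isOpen_iff_mem_nhds.2 fun μ hμ => ?_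
  obtain ⟨t, htU, ht⟩ := μ.exists_atom hμ
  obtain ⟨f, h1, h2, h3⟩ := exists_compactlySupported_eq_one (isCompact_singleton (x := t)) hU
    (singleton_subset_iff.2 htU)
  have hlow : ({t} : Set E).indicator 1 ≤ fun s => (f s : ℝ≥0∞) := by
    refine indicator_le fun s hs => ?_
    simp [h1 s hs]
  have hup : ∀ s, (f s : ℝ≥0∞) ≤ U.indicator 1 s := by
    intro s
    by_cases hs : s ∈ U
    · simpa [hs] using h2 s
    · simp [h3 s hs]
  have hpos : 0 < μ.integral f := by
    refine ht.trans_le ?_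
    rw [← lintegral_indicator_one (measurableSet_singleton t)]
    exact lintegral_mono hlow
  filter_upwards [(isOpen_lt continuous_const (continuous_integral f)).mem_nhds hpos] with κ hκ
  refine (show 0 < κ.integral f from hκ).trans_le ?_
  rw [← lintegral_indicator_one hU.measurableSet]
  exact lintegral_mono hup

/-- A bump function equal to one on `K` and vanishing off a null neighbourhood has integral zero.
Integral below one is an open condition, and by integrality it forces `K` to be null. -/
theorem isOpen_setOf_measure_eq_zero {K : Set E} (hK : IsCompact K) :
    IsOpen {μ : PointMeasure E | μ.toMeasure K = 0} := by
  refine isOpen_iff_mem_nhds.2 fun μ hμ => ?_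
  obtain ⟨U, hU, hKU, hU0⟩ := μ.exists_isOpen_measure_eq_zero hK hμ
  obtain ⟨f, h1, h2, h3⟩ := exists_compactlySupported_eq_one hK hU hKU
  have hlow : K.indicator 1 ≤ fun s => (f s : ℝ≥0∞) := by
    refine indicator_le fun s hs => ?_
    simp [h1 s hs]
  have hup : ∀ s, (f s : ℝ≥0∞) ≤ U.indicator 1 s := by
    intro s
    by_cases hs : s ∈ U
    · simpa [hs] using h2 s
    · simp [h3 s hs]
  have hlt : μ.integral f < 1 := by
    refine lt_of_le_of_lt ?_ zero_lt_one
    rw [← hU0, ← lintegral_indicator_one hU.measurableSet]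
    exact lintegral_mono hup
  filter_upwards [(isOpen_lt (continuous_integral f) continuous_const).mem_nhds hlt] with κ hκ
  refine κ.measure_eq_zero_of_lt_one hK.measurableSet (by rwa [hK.isClosed.closure_eq])
    (lt_of_le_of_lt ?_ (show κ.integral f < 1 from hκ))
  rw [← lintegral_indicator_one hK.measurableSet]
  exact lintegral_mono hlow

theorem countable_atoms (μ : PointMeasure E) : {t | 0 < μ.toMeasure {t}}.Countable := by
  refine Measure.countable_meas_pos_of_disjoint_iUnion (μ := μ.toMeasure) (As := fun t => {t})
    (fun t => measurableSet_singleton t) fun s t hst => ?_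
  simpa [Function.onFun] using hst

end Compact

end PointMeasure

/-! ### Modulus and dilations on the punctured extended line. -/

namespace PuncturedEReal

instance : LocallyCompactSpace PuncturedEReal :=
  (isOpen_compl_singleton (x := (0 : EReal))).locallyCompactSpace

instance : SecondCountableTopology PuncturedEReal :=
  IsInducing.subtypeVal.secondCountableTopology

/-- The modulus of a point of `[-∞,∞] \ {0}`. -/
def modulus (t : PuncturedEReal) : ℝ≥0∞ := (t : EReal).abs

theorem ereal_abs_eq_max (x : EReal) : x.abs = max x.toENNReal (-x).toENNReal := by
  induction x with
  | bot => simp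
  | top => simp
  | coe x =>
    rw [EReal.abs_def, EReal.real_coe_toENNReal, ← EReal.coe_neg, EReal.real_coe_toENNReal,
      ← ENNReal.ofReal_max]
    rfl

theorem continuous_modulus : Continuous modulus := by
  have : modulus = fun t : PuncturedEReal => max (t : EReal).toENNReal (-(t : EReal)).toENNReal :=
    funext fun t => ereal_abs_eq_max t
  rw [this]
  exact (EReal.continuous_toENNReal.comp continuous_subtype_val).max
    (EReal.continuous_toENNReal.comp (continuous_neg.comp continuous_subtype_val))

theorem modulus_pos (t : PuncturedEReal) : 0 < modulus t :=
  pos_iff_ne_zero.2 fun h => t.2 (EReal.abs_eq_zero_iff.1 h)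

theorem isCompact_setOf_le_modulus {c : ℝ≥0∞} (hc : 0 < c) :
    IsCompact {t : PuncturedEReal | c ≤ modulus t} := by
  rw [Subtype.isCompact_iff]
  have : (Subtype.val '' {t : PuncturedEReal | c ≤ modulus t} : Set EReal)
      = {x : EReal | c ≤ max x.toENNReal (-x).toENNReal} := by
    ext x
    simp only [mem_image, mem_ofPred_eq]
    constructor
    · rintro ⟨t, ht, rfl⟩
      rwa [← ereal_abs_eq_max]
    · intro hx
      rw [← ereal_abs_eq_max] at hx
      refine ⟨⟨x, fun h0 => ?_⟩, hx, rfl⟩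
      rw [h0, EReal.abs_zero] at hx
      exact hx.not_gt hc
  rw [this]
  refine IsClosed.isCompact (isClosed_le continuous_const ?_)
  exact EReal.continuous_toENNReal.max (EReal.continuous_toENNReal.comp continuous_neg)

theorem isOpen_setOf_lt_modulus (c : ℝ≥0∞) : IsOpen {t : PuncturedEReal | c < modulus t} :=
  isOpen_lt continuous_const continuous_modulus

/-- Relatively compact sets are bounded away from `0`. -/
theorem exists_subset_outside {B : Set PuncturedEReal} (hB : IsCompact (closure B)) :
    ∃ x : ℝ, 0 < x ∧ B ⊆ outside x := by
  rcases (closure B).eq_empty_or_nonempty with h | h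
  · exact ⟨1, one_pos, fun t ht => absurd (subset_closure ht) (by simp [h])⟩
  · obtain ⟨t, -, ht⟩ := hB.exists_isMinOn h continuous_modulus.continuousOn
    obtain ⟨c, hc0, hc⟩ := ENNReal.lt_iff_exists_nnreal_btwn.1 (modulus_pos t)
    refine ⟨c, by exact_mod_cast hc0, fun s hs => ?_⟩
    show ENNReal.ofReal c < modulus s
    rw [ENNReal.ofReal_coe_nnreal]
    exact hc.trans_le (ht (subset_closure hs))

theorem modulus_dilate (y : Ioi (0 : ℝ)) (t : PuncturedEReal) :
    modulus (dilate y t) = ENNReal.ofReal y * modulus t := by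
  show (((y : ℝ) : EReal) * (t : EReal)).abs = _
  rw [EReal.abs_mul, EReal.abs_def, abs_of_pos (mem_Ioi.1 y.2)]
  rfl

theorem continuous_dilate_uncurry :
    Continuous fun p : Ioi (0 : ℝ) × PuncturedEReal => dilate p.1 p.2 := by
  refine Continuous.subtype_mk (continuous_iff_continuousAt.2 fun p => ?_) _
  have hy : ((p.1 : ℝ) : EReal) ≠ 0 := by exact_mod_cast (ne_of_gt (mem_Ioi.1 p.1.2))
  have h := EReal.continuousAt_mul (p := (((p.1 : ℝ) : EReal), (p.2 : EReal))) (Or.inl hy)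
    (Or.inl hy) (Or.inl (EReal.coe_ne_bot _)) (Or.inl (EReal.coe_ne_top _))
  exact ContinuousAt.comp (f := fun p : Ioi (0 : ℝ) × PuncturedEReal =>
    (((p.1 : ℝ) : EReal), (p.2 : EReal))) h
    ((continuous_coe_real_ereal.comp (continuous_subtype_val.comp continuous_fst)).prodMk
      (continuous_subtype_val.comp continuous_snd)).continuousAt

/-- The inverse of a positive real. -/
def invPos (y : Ioi (0 : ℝ)) : Ioi (0 : ℝ) := ⟨(y : ℝ)⁻¹, mem_Ioi.2 (inv_pos.2 y.2)⟩

theorem continuous_invPos : Continuous invPos :=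
  (Continuous.inv₀ continuous_subtype_val fun y : Ioi (0 : ℝ) => (mem_Ioi.1 y.2).ne').subtype_mk
    fun y => mem_Ioi.2 (inv_pos.2 y.2)

theorem dilate_invPos_dilate (y : Ioi (0 : ℝ)) (t : PuncturedEReal) :
    dilate (invPos y) (dilate y t) = t :=
  dilate_inv _ _ (inv_mul_cancel₀ (mem_Ioi.1 y.2).ne') t

theorem dilate_dilate_invPos (y : Ioi (0 : ℝ)) (t : PuncturedEReal) :
    dilate y (dilate (invPos y) t) = t :=
  dilate_inv _ _ (mul_inv_cancel₀ (mem_Ioi.1 y.2).ne') t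

end PuncturedEReal

/-! ### Largest modulus, scaling and polar coordinates of point measures. -/

open PuncturedEReal

theorem lt_topModulus_iff {c : ℝ≥0∞} {μ : PM} :
    c < topModulus μ ↔ 0 < μ.toMeasure {t | c < modulus t} := by
  simp only [topModulus, lt_iSup_iff]
  constructor
  · rintro ⟨t, ht, hc⟩
    exact ht.trans_le (measure_mono (singleton_subset_iff.2 hc))
  · intro h
    obtain ⟨t, hc, ht⟩ := μ.exists_atom h
    exact ⟨t, ht, hc⟩

theorem MSet_eq (x : ℝ) : MSet x = {μ | ENNReal.ofReal x < topModulus μ} := by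
  ext μ
  simp only [MSet, mem_ofPred_eq, lt_topModulus_iff]
  refine ⟨fun h => h.2, fun h => ⟨?_, h⟩⟩
  rintro rfl
  simp [PointMeasure.null] at h

/-- Exceeding `c` means charging an open set, an open condition. Being below `c` holds nearby
because, for an intermediate `c'`, the set `{c' ≤ |t|}` is compact and null, and so stays null for
nearby measures. -/
theorem continuous_topModulus : Continuous topModulus := by
  refine OrderTopology.continuous_iff.2 fun c => ⟨?_, ?_⟩
  · have : topModulus ⁻¹' Ioi c = {μ | 0 < μ.toMeasure {t | c < modulus t}} := by
      ext μ; exact lt_topModulus_iff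
    rw [this]
    exact PointMeasure.isOpen_setOf_measure_pos (isOpen_setOf_lt_modulus c)
  · refine isOpen_iff_mem_nhds.2 fun μ hμ => ?_
    obtain ⟨c', h1, h2⟩ := exists_between (show topModulus μ < c from hμ)
    have hK := isCompact_setOf_le_modulus (bot_le.trans_lt h1)
    have hμ0 : μ.toMeasure {t | c' ≤ modulus t} = 0 := by
      by_contra hne
      obtain ⟨t, ht, htp⟩ := μ.exists_atom (pos_iff_ne_zero.2 hne)
      exact (ht.trans (le_iSup₂_of_le (f := fun (t : PuncturedEReal)
        (_ : 0 < μ.toMeasure {t}) => (t : EReal).abs) t htp le_rfl)).not_gt h1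
    filter_upwards [(PointMeasure.isOpen_setOf_measure_eq_zero hK).mem_nhds hμ0] with κ hκ
    refine lt_of_le_of_lt (not_lt.1 fun h => ?_) h2
    rw [lt_topModulus_iff] at h
    exact h.ne' (measure_mono_null (fun t (ht : c' < modulus t) => ht.le) hκ)

theorem scale_toMeasure_apply (y : Ioi (0 : ℝ)) (μ : PM) {B : Set PuncturedEReal}
    (hB : MeasurableSet B) : (scale y μ).toMeasure B = μ.toMeasure (dilate y ⁻¹' B) :=
  Measure.map_apply (continuous_dilate y).measurable hB

theorem scale_integral (y : Ioi (0 : ℝ)) (μ : PM) {f : PuncturedEReal → ℝ≥0} (hf : Measurable f) :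
    (scale y μ).integral f = μ.integral fun t => f (dilate y t) :=
  lintegral_map hf.coe_nnreal_ennreal (continuous_dilate y).measurable

theorem scale_invPos_scale (y : Ioi (0 : ℝ)) (μ : PM) : scale (invPos y) (scale y μ) = μ := by
  refine PointMeasure.ext_toMeasure ?_
  show (μ.toMeasure.map (dilate y)).map (dilate (invPos y)) = _
  rw [Measure.map_map (continuous_dilate _).measurable (continuous_dilate _).measurable]
  have : dilate (invPos y) ∘ dilate y = id := funext fun t => dilate_invPos_dilate y t
  rw [this, Measure.map_id]

theorem scale_scale_invPos (y : Ioi (0 : ℝ)) (μ : PM) : scale y (scale (invPos y) μ) = μ := by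
  refine PointMeasure.ext_toMeasure ?_
  show (μ.toMeasure.map (dilate (invPos y))).map (dilate y) = _
  rw [Measure.map_map (continuous_dilate _).measurable (continuous_dilate _).measurable]
  have : dilate y ∘ dilate (invPos y) = id := funext fun t => dilate_dilate_invPos y t
  rw [this, Measure.map_id]

theorem topModulus_scale (y : Ioi (0 : ℝ)) (μ : PM) :
    topModulus (scale y μ) = ENNReal.ofReal y * topModulus μ := by
  have hy : ENNReal.ofReal y ≠ 0 := by simpa using mem_Ioi.1 y.2
  refine eq_of_forall_lt_iff fun c => ?_
  have h1 : ∀ b : ℝ≥0∞, c < ENNReal.ofReal y * b ↔ c / ENNReal.ofReal y < b := fun b => by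
    rw [ENNReal.div_lt_iff (Or.inl hy) (Or.inl ENNReal.ofReal_ne_top), mul_comm]
  rw [h1, lt_topModulus_iff, lt_topModulus_iff,
    scale_toMeasure_apply y μ (isOpen_setOf_lt_modulus c).measurableSet]
  have : dilate y ⁻¹' {t | c < modulus t} = {t | c / ENNReal.ofReal y < modulus t} := by
    ext t
    simp only [mem_preimage, mem_ofPred_eq, modulus_dilate, h1]
  rw [this]

/-- Moving the dilation onto the test function, `f ∘ dilate y` tends to `f ∘ dilate y₀` uniformly,
with supports in a common compact set. The error is thus at most `δ * h` for a fixed test function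
`h`, whatever the measure. -/
theorem continuous_scale_uncurry : Continuous fun p : Ioi (0 : ℝ) × PM => scale p.1 p.2 := by
  refine PointMeasure.continuous_of_integral fun f => continuous_iff_continuousAt.2 ?_
  rintro ⟨y₀, μ₀⟩
  have : LocallyCompactSpace (Ioi (0 : ℝ)) := isOpen_Ioi.locallyCompactSpace
  obtain ⟨V, hV, hVn⟩ := exists_compact_mem_nhds y₀
  -- This compact set contains the support of `f ∘ dilate y` for every `y` in the compact
  -- neighbourhood `V`.
  let K : Set PuncturedEReal :=
    (fun p : Ioi (0 : ℝ) × PuncturedEReal => dilate (invPos p.1) p.2) '' (V ×ˢ tsupport f)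
  have hK : IsCompact K := (hV.prod f.hasCompactSupport).image
    (continuous_dilate_uncurry.comp (continuous_invPos.prodMap continuous_id))
  have hoff : ∀ y ∈ V, ∀ t ∉ K, f (dilate y t) = 0 := by
    intro y hy t ht
    by_contra hne
    exact ht ⟨(y, dilate y t), ⟨hy, subset_tsupport _ hne⟩, dilate_invPos_dilate y t⟩
  obtain ⟨h, h1, -, -⟩ := exists_compactlySupported_eq_one hK isOpen_univ (subset_univ K)
  -- Currying turns joint continuity into continuity for the compact-open topology, that is, uniform
  -- convergence on `K`.
  let F : C(Ioi (0 : ℝ), C(PuncturedEReal, ℝ≥0)) := ContinuousMap.curry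
    ⟨fun p : Ioi (0 : ℝ) × PuncturedEReal => f (dilate p.1 p.2),
      f.continuous.comp continuous_dilate_uncurry⟩
  let d : C_c(PuncturedEReal, ℝ≥0) :=
    ⟨F y₀, HasCompactSupport.intro hK fun t ht => hoff y₀ (mem_of_mem_nhds hVn) t ht⟩
  have hint : ∀ p : Ioi (0 : ℝ) × PM,
      (scale p.1 p.2).integral f = p.2.integral fun t => f (dilate p.1 t) :=
    fun p => scale_integral _ _ f.continuous.measurable
  refine continuousAt_of_approximating (H := fun p => p.2.integral h)
    (PointMeasure.integral_lt_top _ f).ne (PointMeasure.integral_lt_top _ h).ne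
    ((PointMeasure.continuous_integral h).comp continuous_snd).continuousAt fun δ hδ => ?_
  refine ⟨fun p => p.2.integral d, (PointMeasure.integral_lt_top _ d).ne,
    ((PointMeasure.continuous_integral d).comp continuous_snd).continuousAt, ?_⟩
  have hunif := Metric.tendstoUniformlyOn_iff.1
    ((ContinuousMap.tendsto_iff_forall_isCompact_tendstoUniformlyOn).1
      (F.continuous.tendsto y₀) K hK) δ hδ
  have hev : ∀ᶠ y in 𝓝 y₀, ∀ t, f (dilate y t) ≤ d t + δ * h t ∧ d t ≤ f (dilate y t) + δ * h t := by
    filter_upwards [hunif, hVn] with y hy hyV t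
    by_cases ht : t ∈ K
    · have hd : dist (d t) (f (dilate y t)) < δ := hy t ht
      rw [NNReal.dist_eq, abs_lt] at hd
      rw [h1 t ht, mul_one]
      constructor
      · rw [← NNReal.coe_le_coe]; push_cast; linarith [hd.1]
      · rw [← NNReal.coe_le_coe]; push_cast; linarith [hd.2]
    · have h2 : d t = 0 := hoff y₀ (mem_of_mem_nhds hVn) t ht
      simp [h2, hoff y hyV t ht]
  filter_upwards [(continuous_fst.tendsto ((y₀, μ₀) : Ioi (0 : ℝ) × PM)).eventually hev,
    (continuous_fst.tendsto ((y₀, μ₀) : Ioi (0 : ℝ) × PM)).eventually hVn] with p hp hpV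
  let g : C_c(PuncturedEReal, ℝ≥0) :=
    ⟨F p.1, HasCompactSupport.intro hK fun t ht => hoff p.1 hpV t ht⟩
  rw [hint]
  exact ⟨PointMeasure.integral_le_add_mul (f := g) (g := d) _ fun t => (hp t).1,
    PointMeasure.integral_le_add_mul (f := d) (g := g) _ fun t => (hp t).2⟩

theorem continuous_scale (y : Ioi (0 : ℝ)) : Continuous (scale y) :=
  continuous_scale_uncurry.comp (Continuous.prodMk_right y)

/-- The largest modulus of an atom, as a positive real; `1` by convention if it is `0` or `∞`. -/
def radius (μ : PM) : Ioi (0 : ℝ) :=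
  if h : 0 < (topModulus μ).toReal then ⟨(topModulus μ).toReal, h⟩ else ⟨1, mem_Ioi.2 one_pos⟩

/-- The point measure rescaled so that its largest modulus is `1`. -/
def normalise (μ : PM) : PM := scale (invPos (radius μ)) μ

/-- The nonzero point measures without mass at infinity. -/
def finiteNonzero : Set PM := {μ | 0 < topModulus μ ∧ topModulus μ < ∞}

theorem isOpen_finiteNonzero : IsOpen finiteNonzero :=
  (isOpen_lt continuous_const continuous_topModulus).inter
    (isOpen_lt continuous_topModulus continuous_const)

theorem coe_radius {μ : PM} (h : μ ∈ finiteNonzero) : (radius μ : ℝ) = (topModulus μ).toReal := by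
  rw [radius, dif_pos (ENNReal.toReal_pos h.1.ne' h.2.ne)]

theorem continuousOn_radius : ContinuousOn radius finiteNonzero := by
  rw [Topology.IsInducing.subtypeVal.continuousOn_iff]
  refine ContinuousOn.congr (f := fun μ => (topModulus μ).toReal) ?_ fun μ hμ => coe_radius hμ
  intro μ hμ
  exact ((ENNReal.continuousAt_toReal hμ.2.ne).comp
    continuous_topModulus.continuousAt).continuousWithinAt

theorem continuousOn_normalise : ContinuousOn normalise finiteNonzero :=
  continuous_scale_uncurry.comp_continuousOn
    ((continuous_invPos.comp_continuousOn continuousOn_radius).prodMk continuousOn_id)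

theorem measurable_radius : Measurable radius := by
  have hm : Measurable fun μ => (topModulus μ).toReal := continuous_topModulus.measurable.ennreal_toReal
  have : Measurable fun μ => (radius μ : ℝ) := by
    have he : (fun μ => (radius μ : ℝ))
        = fun μ => if 0 < (topModulus μ).toReal then (topModulus μ).toReal else 1 := by
      funext μ
      unfold radius
      split_ifs <;> rfl
    rw [he]
    exact Measurable.ite (measurableSet_lt measurable_const hm) hm measurable_const
  exact this.subtype_mk (h := fun μ => (radius μ).2)

theorem measurable_scale_uncurry : Measurable fun p : Ioi (0 : ℝ) × PM => scale p.1 p.2 :=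
  continuous_scale_uncurry.measurable

theorem measurable_normalise : Measurable normalise :=
  measurable_scale_uncurry.comp
    ((continuous_invPos.measurable.comp measurable_radius).prodMk measurable_id)

theorem scale_radius_normalise (μ : PM) : scale (radius μ) (normalise μ) = μ :=
  scale_scale_invPos _ _

theorem topModulus_of_mem_MTilde {μ : PM} (h : μ ∈ MTilde) : topModulus μ = 1 := by
  refine le_antisymm (not_lt.1 fun h1 => ?_) ?_
  · rw [lt_topModulus_iff] at h1
    refine h1.ne' ?_
    have := h.1
    simpa [outside] using! this
  · obtain ⟨t, ht, htp⟩ := μ.exists_atom h.2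
    refine le_iSup₂_of_le (f := fun (t : PuncturedEReal)
        (_ : 0 < μ.toMeasure {t}) => (t : EReal).abs) t htp ?_
    rcases ht with ht | ht <;> rw [ht]
    · rw [EReal.abs_neg, ← EReal.coe_one, EReal.abs_def]; simp
    · rw [← EReal.coe_one, EReal.abs_def]; simp

theorem topModulus_scale_of_mem_MTilde {μ : PM} (h : μ ∈ MTilde) (y : Ioi (0 : ℝ)) : topModulus (scale y μ) = ENNReal.ofReal y := by
  rw [topModulus_scale, topModulus_of_mem_MTilde h, mul_one]

theorem scale_mem_finiteNonzero {μ : PM} (h : μ ∈ MTilde) (y : Ioi (0 : ℝ)) : scale y μ ∈ finiteNonzero := by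
  rw [finiteNonzero, mem_ofPred_eq, topModulus_scale_of_mem_MTilde h]
  exact ⟨by simpa using mem_Ioi.1 y.2, ENNReal.ofReal_lt_top⟩

theorem radius_scale {μ : PM} (h : μ ∈ MTilde) (y : Ioi (0 : ℝ)) : radius (scale y μ) = y := by
  refine Subtype.ext ?_
  rw [coe_radius (scale_mem_finiteNonzero h y), topModulus_scale_of_mem_MTilde h,
    ENNReal.toReal_ofReal (mem_Ioi.1 y.2).le]

/-- With `radius_scale` and `scale_radius_normalise`, this makes polar coordinates inverse to
scaling. -/
theorem normalise_scale {μ : PM} (h : μ ∈ MTilde) (y : Ioi (0 : ℝ)) : normalise (scale y μ) = μ := by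
  rw [normalise, radius_scale h, scale_invPos_scale]

/-! The intensity `ν` and the canonical measure `λ`. -/

theorem measurableSet_setOf_lt_coe (x : ℝ) : MeasurableSet {y : Ioi (0 : ℝ) | x < (y : ℝ)} :=
  measurableSet_lt measurable_const measurable_subtype_coe

theorem nuMeasure_setOf_lt {θ α : ℝ} (hθ : 0 ≤ θ) (hα : 0 < α) {x : ℝ} (hx : 0 < x) :
    nuMeasure θ α {y | x < (y : ℝ)} = ENNReal.ofReal (θ * x ^ (-α)) := by
  have himg : (Subtype.val '' {y : Ioi (0 : ℝ) | x < (y : ℝ)} : Set ℝ) = Ioi x := by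
    ext z
    simp only [mem_image, mem_ofPred_eq, mem_Ioi]
    exact ⟨fun ⟨y, hy, h⟩ => h ▸ hy, fun h => ⟨⟨z, mem_Ioi.2 (hx.trans h)⟩, h, rfl⟩⟩
  have hlt : -α - 1 < -1 := by linarith
  rw [nuMeasure, withDensity_apply _ (measurableSet_setOf_lt_coe x),
    setLIntegral_subtype measurableSet_Ioi _ (fun y => ENNReal.ofReal (θ * α * y ^ (-α - 1))), himg,
    ← ofReal_integral_eq_lintegral_ofReal]
  · rw [integral_const_mul, integral_Ioi_rpow_of_lt hlt hx]
    congr 1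
    rw [sub_add_cancel]
    field_simp
  · exact (integrableOn_Ioi_rpow_of_lt hlt hx).const_mul _
  · filter_upwards [ae_restrict_mem measurableSet_Ioi] with y hy
    have : (0 : ℝ) < y := hx.trans hy
    show (0 : ℝ) ≤ _
    positivity

theorem nuMeasure_setOf_lt_pos {θ α : ℝ} (hθ : 0 < θ) (hα : 0 < α) {x : ℝ} (hx : 0 < x) :
    0 < nuMeasure θ α {y | x < (y : ℝ)} := by
  rw [nuMeasure_setOf_lt hθ.le hα hx]
  exact ENNReal.ofReal_pos.2 (by positivity)

theorem nuMeasure_setOf_lt_ne_top {θ α : ℝ} (hθ : 0 ≤ θ) (hα : 0 < α) {x : ℝ} (hx : 0 < x) :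
    nuMeasure θ α {y | x < (y : ℝ)} ≠ ∞ := by
  rw [nuMeasure_setOf_lt hθ hα hx]
  exact ENNReal.ofReal_ne_top

theorem sigmaFinite_nuMeasure {θ α : ℝ} (hθ : 0 ≤ θ) (hα : 0 < α) :
    SigmaFinite (nuMeasure θ α) := by
  refine ⟨⟨⟨fun n : ℕ => {y | 1 / ((n : ℝ) + 1) < (y : ℝ)}, fun _ => trivial,
    fun n => (nuMeasure_setOf_lt_ne_top hθ hα (by positivity)).lt_top, ?_⟩⟩⟩
  refine eq_univ_of_forall fun y => ?_
  obtain ⟨n, hn⟩ := exists_nat_one_div_lt (mem_Ioi.1 y.2)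
  exact mem_iUnion.2 ⟨n, hn⟩

theorem nuMeasure_countable (θ α : ℝ) {s : Set (Ioi (0 : ℝ))} (hs : s.Countable) :
    nuMeasure θ α s = 0 := by
  refine withDensity_absolutelyContinuous _ _ ?_
  rw [(MeasurableEmbedding.subtype_coe measurableSet_Ioi).comap_apply]
  exact (hs.image _).measure_zero _

theorem measurable_scale (y : Ioi (0 : ℝ)) : Measurable (scale y) := (continuous_scale y).measurable

theorem measurable_kernelK (Q : Measure PM) [IsFiniteMeasure Q] : Measurable (kernelK Q) := by
  refine Measure.measurable_of_measurable_coe _ fun s hs => ?_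
  have h := measurable_measure_prodMk_left (ν := Q.restrict MTilde) (measurable_scale_uncurry hs)
  have he : (fun y => kernelK Q y s) = fun y =>
      (Q.restrict MTilde) (Prod.mk y ⁻¹' ((fun p : Ioi (0 : ℝ) × PM => scale p.1 p.2) ⁻¹' s)) := by
    funext y
    rw [kernelK, Measure.map_apply (measurable_scale y) hs]
    rfl
  rw [he]
  exact h

theorem measurableSet_MSet (x : ℝ) : MeasurableSet (MSet x) := by
  rw [MSet_eq]
  exact measurableSet_lt measurable_const continuous_topModulus.measurable

theorem isOpen_MSet (x : ℝ) : IsOpen (MSet x) := by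
  rw [MSet_eq]
  exact isOpen_lt continuous_const continuous_topModulus

theorem MSet_anti {x y : ℝ} (h : x ≤ y) : MSet y ⊆ MSet x := by
  rw [MSet_eq, MSet_eq]
  exact fun μ hμ => lt_of_le_of_lt (ENNReal.ofReal_le_ofReal h) hμ

section Canonical

theorem kernelK_apply {Q : Measure PM} (hQ : Q MTildeᶜ = 0) (y : Ioi (0 : ℝ)) {s : Set PM} (hs : MeasurableSet s) :
    kernelK Q y s = Q (scale y ⁻¹' s) := by
  have h : Q.restrict MTilde = Q := Measure.restrict_eq_self_of_ae_mem (mem_ae_iff.2 hQ)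
  rw [kernelK, h, Measure.map_apply (measurable_scale y) hs]

variable {Q : Measure PM} [IsProbabilityMeasure Q]

theorem lambdaMeasure_apply (hQ : Q MTildeᶜ = 0) (θ α : ℝ) {s : Set PM} (hs : MeasurableSet s) :
    lambdaMeasure θ α Q s = ∫⁻ y, Q (scale y ⁻¹' s) ∂(nuMeasure θ α) := by
  rw [lambdaMeasure, Measure.bind_apply hs (measurable_kernelK Q).aemeasurable]
  exact lintegral_congr fun y => kernelK_apply hQ y hs

/-- A set missed by all dilations of measures in `MTilde` is negligible. -/
theorem lambdaMeasure_eq_zero (hQ : Q MTildeᶜ = 0) (θ α : ℝ) {s : Set PM} (hs : MeasurableSet s)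
    (h : ∀ y, ∀ μ ∈ MTilde, scale y μ ∉ s) : lambdaMeasure θ α Q s = 0 := by
  rw [lambdaMeasure_apply hQ θ α hs, lintegral_eq_zero_of_ae_eq_zero]
  exact ae_of_all _ fun y => measure_mono_null (fun μ hμ hM => h y μ hM hμ) hQ

theorem scale_mem_MSet {μ : PM} (h : μ ∈ MTilde) (y : Ioi (0 : ℝ)) (x : ℝ) :
    scale y μ ∈ MSet x ↔ x < (y : ℝ) := by
  rw [MSet_eq, mem_ofPred_eq, topModulus_scale_of_mem_MTilde h,
    ENNReal.ofReal_lt_ofReal_iff (mem_Ioi.1 y.2)]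

/-- The dilation by `y` of a measure in `MTilde` has largest modulus `y`, so intersecting with `MSet
x` just restricts the integral to `y > x`. -/
theorem lambdaMeasure_inter_MSet (hQ : Q MTildeᶜ = 0) (θ α : ℝ) (x : ℝ) {M : Set PM}
    (hM : MeasurableSet M) : lambdaMeasure θ α Q (M ∩ MSet x)
      = ∫⁻ y in {y : Ioi (0 : ℝ) | x < (y : ℝ)}, Q (scale y ⁻¹' M) ∂(nuMeasure θ α) := by
  rw [lambdaMeasure_apply hQ θ α (hM.inter (measurableSet_MSet x)),
    ← lintegral_indicator (measurableSet_setOf_lt_coe x)]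
  refine lintegral_congr fun y => ?_
  by_cases hy : x < (y : ℝ)
  · rw [indicator_of_mem (by exact hy)]
    refine measure_congr ?_
    filter_upwards [mem_ae_iff.2 hQ] with μ hμ
    exact propext ⟨fun h => h.1, fun h => ⟨h, (scale_mem_MSet hμ y x).2 hy⟩⟩
  · rw [indicator_of_notMem (by exact hy)]
    exact measure_mono_null (fun μ hμ hM' => hy ((scale_mem_MSet hM' y x).1 hμ.2)) hQ

theorem lambdaMeasure_MSet (hQ : Q MTildeᶜ = 0) (θ α : ℝ) (x : ℝ) :
    lambdaMeasure θ α Q (MSet x) = nuMeasure θ α {y | x < (y : ℝ)} := by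
  have h := lambdaMeasure_inter_MSet hQ θ α x MeasurableSet.univ
  simpa using h

theorem expNeg_le_one (t : ℝ≥0∞) : expNeg t ≤ 1 := by
  rw [expNeg, EReal.exp_le_one_iff, EReal.neg_le, neg_zero]
  exact EReal.coe_ennreal_nonneg t

theorem expNeg_zero : expNeg 0 = 1 := by simp [expNeg]

theorem expNeg_lt_one {t : ℝ≥0∞} (h : t ≠ 0) : expNeg t < 1 := by
  rw [expNeg, EReal.exp_lt_one_iff, EReal.neg_lt_comm, neg_zero]
  exact_mod_cast pos_iff_ne_zero.2 h

/-- A relatively compact `B` stays away from `0`, so `1 - e^{-μ(B)}` is at most the indicator of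
some `MSet x`, whose mass is finite. -/
theorem isCanonicalMeasure_lambdaMeasure (hQ : Q MTildeᶜ = 0) {θ α : ℝ} (hθ : 0 ≤ θ)
    (hα : 0 < α) : IsCanonicalMeasure (lambdaMeasure θ α Q) := by
  refine ⟨?_, fun B hB hc => ?_⟩
  · have hm : MeasurableSet {μ : PM | topModulus μ = 0} :=
      continuous_topModulus.measurable (measurableSet_singleton 0)
    refine measure_mono_null ?_ (lambdaMeasure_eq_zero hQ θ α hm fun y μ hμ h =>
      (scale_mem_finiteNonzero hμ y).1.ne' h)
    rintro _ rfl
    simp [topModulus, PointMeasure.null]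
  · obtain ⟨x, hx, hBx⟩ := exists_subset_outside hc
    calc ∫⁻ μ, (1 - expNeg (μ.toMeasure B)) ∂(lambdaMeasure θ α Q)
        ≤ ∫⁻ μ, (MSet x).indicator 1 μ ∂(lambdaMeasure θ α Q) := by
          refine lintegral_mono fun μ => ?_
          by_cases hμ : μ.toMeasure B = 0
          · simp [hμ, expNeg_zero]
          · have hB0 := pos_iff_ne_zero.2 hμ
            have hmem : μ ∈ MSet x := by
              refine ⟨?_, hB0.trans_le (measure_mono hBx)⟩
              rintro rfl
              exact hμ (by simp [PointMeasure.null])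
            rw [indicator_of_mem hmem]
            exact tsub_le_self
      _ = nuMeasure θ α {y | x < (y : ℝ)} := by
          rw [lintegral_indicator_one (measurableSet_MSet x), lambdaMeasure_MSet hQ]
      _ < ∞ := (nuMeasure_setOf_lt_ne_top hθ hα hx).lt_top

theorem measurableSet_setOf_measure_pos {K : Set PuncturedEReal} (hK : IsCompact K) :
    MeasurableSet {μ : PM | 0 < μ.toMeasure K} :=
  measurableSet_lt measurable_const (PointMeasure.measurable_measure_of_isCompact hK)

end Canonical

/-- An infinitely divisible point process does not charge a compact set that is null for almost
every measure under the canonical measure. -/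
theorem IsInfDivLaw.measure_pos_eq_zero {R L : Measure PM} (h : IsInfDivLaw R L)
    {K : Set PuncturedEReal} (hK : IsCompact K) (hL : L {μ | 0 < μ.toMeasure K} = 0) :
    R {μ | 0 < μ.toMeasure K} = 0 := by
  obtain ⟨hR, -, hlap⟩ := h
  have hf : Measurable (K.indicator (1 : PuncturedEReal → ℝ≥0)) :=
    measurable_one.indicator hK.measurableSet
  have hint : ∀ μ : PM, μ.integral (K.indicator 1) = μ.toMeasure K := by
    intro μ
    rw [← lintegral_indicator_one hK.measurableSet]
    refine lintegral_congr fun t => ?_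
    by_cases ht : t ∈ K <;> simp [ht]
  have h1 := hlap _ hf
  simp only [laplace, hint, id] at h1
  have h0 : ∫⁻ μ, (1 - expNeg (μ.toMeasure K)) ∂L = 0 := by
    refine lintegral_eq_zero_of_ae_eq_zero ?_
    have : ∀ᵐ μ ∂L, ¬ 0 < μ.toMeasure K := by
      rw [ae_iff]; simpa only [not_not] using hL
    filter_upwards [this] with μ hμ
    simp [nonpos_iff_eq_zero.1 (not_lt.1 hμ), expNeg_zero]
  rw [h0, expNeg_zero] at h1
  -- The Laplace functional at the indicator of `K` is one, while its integrand is at most one;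
  -- hence the integrand is one almost surely.
  have hae := ae_eq_of_ae_le_of_lintegral_le (μ := R) (f := fun μ : PM => expNeg (μ.toMeasure K))
    (g := fun _ => 1) (ae_of_all _ fun μ => expNeg_le_one _) (by rw [h1]; simp) (by fun_prop)
    (by rw [h1]; simp)
  have : ∀ᵐ μ ∂(R), ¬ 0 < μ.toMeasure K := by
    filter_upwards [hae] with μ hμ hpos
    exact (expNeg_lt_one hpos.ne').ne hμ
  rw [ae_iff] at this
  simpa only [not_not] using this

/-! ### Mass at infinity and fixed atoms. -/

section FixedAtoms

variable {Q : Measure PM} [IsProbabilityMeasure Q]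

theorem setOf_top_or_bot_eq :
    {t : PuncturedEReal | (t : EReal) = ⊤ ∨ (t : EReal) = ⊥} = {t | ⊤ ≤ modulus t} := by
  ext ⟨t, ht⟩
  simp only [mem_ofPred_eq, modulus, top_le_iff]
  induction t with
  | bot => simp
  | top => simp
  | coe t => simp [EReal.abs_def]

theorem lambdaMeasure_charging_infinity (hQ : Q MTildeᶜ = 0) (θ α : ℝ) :
    lambdaMeasure θ α Q {μ | 0 < μ.toMeasure {t | ⊤ ≤ modulus t}} = 0 := by
  refine lambdaMeasure_eq_zero hQ θ α
    (measurableSet_setOf_measure_pos (isCompact_setOf_le_modulus ENNReal.zero_lt_top))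
    fun y μ hμ h => ?_
  have hlt := (scale_mem_finiteNonzero hμ y).2
  obtain ⟨t, ht, htp⟩ := (scale y μ).exists_atom h
  exact hlt.ne (top_le_iff.1 (ht.trans (le_iSup₂_of_le (f := fun (t : PuncturedEReal)
    (_ : 0 < (scale y μ).toMeasure {t}) => (t : EReal).abs) t htp le_rfl)))

/-- By Fubini, fix `μ`: the dilation by `y` has an atom at `t` only if `t / y` is one of the
countably many atoms of `μ`, and `ν` does not charge the countable set of such `y`. Finiteness of
`t` makes `y ↦ t / y` injective. -/
theorem lambdaMeasure_charging_point (hQ : Q MTildeᶜ = 0) {θ α : ℝ} (hθ : 0 ≤ θ) (hα : 0 < α)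
    {t : PuncturedEReal} (ht : modulus t ≠ ∞) :
    lambdaMeasure θ α Q {μ | 0 < μ.toMeasure {t}} = 0 := by
  have := sigmaFinite_nuMeasure hθ hα
  set s : Set PM := {μ | 0 < μ.toMeasure {t}}
  have hs : MeasurableSet s := measurableSet_setOf_measure_pos isCompact_singleton
  have hA : MeasurableSet ((fun p : Ioi (0 : ℝ) × PM => scale p.1 p.2) ⁻¹' s) :=
    measurable_scale_uncurry hs
  have h1 : lambdaMeasure θ α Q s = ((nuMeasure θ α).prod Q)
      ((fun p : Ioi (0 : ℝ) × PM => scale p.1 p.2) ⁻¹' s) := by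
    rw [lambdaMeasure_apply hQ θ α hs, Measure.prod_apply hA]
    rfl
  rw [h1, Measure.prod_apply_symm hA]
  refine lintegral_eq_zero_of_ae_eq_zero (ae_of_all _ fun μ => nuMeasure_countable θ α ?_)
  have hinj : Function.Injective fun y : Ioi (0 : ℝ) => dilate (invPos y) t := by
    intro y z hyz
    have h2 := congrArg modulus hyz
    simp only [modulus_dilate] at h2
    rw [ENNReal.mul_left_inj (modulus_pos t).ne' ht] at h2
    have h3 : ((y : ℝ))⁻¹ = (z : ℝ)⁻¹ :=
      (ENNReal.ofReal_eq_ofReal_iff (inv_nonneg.2 (mem_Ioi.1 y.2).le)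
        (inv_nonneg.2 (mem_Ioi.1 z.2).le)).1 h2
    exact Subtype.ext (inv_injective h3)
  refine (μ.countable_atoms.preimage_of_injOn hinj.injOn).mono fun y hy => ?_
  have hy' : 0 < (scale y μ).toMeasure {t} := hy
  rw [scale_toMeasure_apply y μ (measurableSet_singleton t)] at hy'
  refine hy'.trans_le (measure_mono fun u hu => ?_)
  rw [mem_preimage, mem_singleton_iff] at hu
  rw [mem_singleton_iff, ← hu]
  exact (dilate_invPos_dilate y u).symm

theorem fixedAtomModuli_eq_empty (hQ : Q MTildeᶜ = 0) {θ α : ℝ} (hθ : 0 ≤ θ) (hα : 0 < α)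
    {R : Measure PM} (hR : IsInfDivLaw R (lambdaMeasure θ α Q)) : fixedAtomModuli R = ∅ := by
  refine eq_empty_of_forall_notMem ?_
  rintro x ⟨-, t, ht, hpos⟩
  refine hpos.ne' (hR.measure_pos_eq_zero isCompact_singleton
    (lambdaMeasure_charging_point hQ hθ hα ?_))
  unfold modulus
  rcases ht with ht | ht <;> rw [ht] <;> exact (EReal.abs_coe_lt_top _).ne

end FixedAtoms

/-! Weak convergence and convergence on continuity sets. -/

section WeakConvergence

variable {X : Type*} [MeasurableSpace X]

open Classical in
/-- A measure as a probability measure, with a default value if it is not one. -/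
def toProbability (μ : Measure X) (d : ProbabilityMeasure X) : ProbabilityMeasure X :=
  if h : IsProbabilityMeasure μ then (⟨μ, h⟩ : ProbabilityMeasure X) else d

theorem coe_toProbability (μ : Measure X) [h : IsProbabilityMeasure μ] (d : ProbabilityMeasure X) :
    (toProbability μ d : Measure X) = μ := by
  have : toProbability μ d = ⟨μ, h⟩ := dif_pos h
  rw [this]
  rfl

variable [TopologicalSpace X] [BorelSpace X] [TopologicalSpace.PseudoMetrizableSpace X]

/-- The portmanteau theorem. The measures need be probabilities only eventually, since a conditional
law given a null event is zero; those exceptions are replaced by a default. -/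
theorem weaklyConverges_iff_null_frontier {μs : ℕ → Measure X}
    (hμs : ∀ᶠ n in atTop, IsProbabilityMeasure (μs n)) (Q : Measure X) [hQ : IsProbabilityMeasure Q] :
    WeaklyConverges μs Q ↔ ∀ V : Set X, MeasurableSet V → Q (frontier V) = 0 →
      Tendsto (fun n => μs n V) atTop (𝓝 (Q V)) := by
  let q : ProbabilityMeasure X := ⟨Q, hQ⟩
  let ps : ℕ → ProbabilityMeasure X := fun n => toProbability (μs n) q
  have hps : ∀ᶠ n in atTop, (ps n : Measure X) = μs n := by
    filter_upwards [hμs] with n hn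
    exact coe_toProbability (μs n) q
  have h1 : WeaklyConverges μs Q ↔ Tendsto ps atTop (𝓝 q) := by
    rw [ProbabilityMeasure.tendsto_iff_forall_integral_tendsto]
    refine forall_congr' fun h => tendsto_congr' ?_
    filter_upwards [hps] with n hn
    rw [hn]
  rw [h1]
  constructor
  · intro h V _ hV
    refine (ProbabilityMeasure.tendsto_measure_of_null_frontier_of_tendsto' h (E := V) hV).congr' ?_
    filter_upwards [hps] with n hn
    rw [hn]
  · intro h
    refine tendsto_of_forall_isOpen_le_liminf' fun G hG => ?_
    refine le_liminf_measure_open_of_forall_tendsto_measure (μ := (q : Measure X))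
      (μs := fun n => (ps n : Measure X)) (fun {V} hV hV0 => ?_) G hG
    refine (h V hV hV0).congr' ?_
    filter_upwards [hps] with n hn
    rw [hn]

end WeakConvergence

/-! ### Conditional probabilities versus weighted masses. -/

section Conditioning

variable {X : Type*} [MeasurableSpace X] {m : ℕ → Measure X} {w : ℕ → ℝ≥0∞} {A : Set X} {ρ : ℝ≥0∞}

theorem eventually_isProbabilityMeasure_cond [∀ n, IsFiniteMeasure (m n)]
    (h : Tendsto (fun n => w n * m n A) atTop (𝓝 ρ)) (hρ : 0 < ρ) :
    ∀ᶠ n in atTop, IsProbabilityMeasure ((m n)[|A]) := by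
  filter_upwards [h.eventually (lt_mem_nhds hρ)] with n hn
  refine cond_isProbabilityMeasure fun h0 => ?_
  simp [h0] at hn

/-- The conditional probability is the quotient of `w n * m n (A ∩ B)` by `w n * m n A`, whose limit
`ρ` is positive and finite. -/
theorem tendsto_cond_iff [∀ n, IsFiniteMeasure (m n)] (hA : MeasurableSet A)
    (hw : ∀ n, w n ≠ ∞) (h : Tendsto (fun n => w n * m n A) atTop (𝓝 ρ)) (hρ : 0 < ρ)
    (hρ' : ρ ≠ ∞) (B : Set X) (q : ℝ≥0∞) (hq : q ≠ ∞) :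
    Tendsto (fun n => (m n)[|A] B) atTop (𝓝 q) ↔
      Tendsto (fun n => w n * m n (A ∩ B)) atTop (𝓝 (ρ * q)) := by
  have hne : ∀ᶠ n in atTop, w n * m n A ≠ 0 := by
    filter_upwards [h.eventually (lt_mem_nhds hρ)] with n hn using hn.ne'
  constructor
  · intro hB
    refine (ENNReal.Tendsto.mul h (Or.inr hq) hB (Or.inr hρ')).congr' ?_
    filter_upwards [hne] with n hn
    have hm : m n A ≠ 0 := right_ne_zero_of_mul hn
    rw [cond_apply hA, mul_assoc, ← mul_assoc (m n A),
      ENNReal.mul_inv_cancel hm (measure_ne_top _ _), one_mul]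
  · intro hB
    have h2 := ENNReal.Tendsto.mul (tendsto_inv_iff.2 h) (Or.inr (by finiteness)) hB
      (Or.inr (by simpa using hρ.ne'))
    rw [← mul_assoc, ENNReal.inv_mul_cancel hρ.ne' hρ', one_mul] at h2
    refine h2.congr' ?_
    filter_upwards [hne] with n hn
    have hm : m n A ≠ 0 := right_ne_zero_of_mul hn
    have hwn : w n ≠ 0 := left_ne_zero_of_mul hn
    rw [cond_apply hA, ENNReal.mul_inv (Or.inl hwn) (Or.inl (hw n)), mul_comm (w n)⁻¹, mul_assoc,
      ← mul_assoc (w n)⁻¹, ENNReal.inv_mul_cancel hwn (hw n), one_mul]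

end Conditioning

/-! ### Equivalence of the two modes of convergence. -/

section Convergence

variable {m : ℕ → Measure PM} {w : ℕ → ℝ≥0∞}
  {Q : Measure PM} {θ α : ℝ}

/-- Joint convergence of the radius and the normalised point measure under `w_n m_n`. -/
def JointConverges (m : ℕ → Measure PM) (w : ℕ → ℝ≥0∞) (Q : Measure PM) (θ α : ℝ) : Prop :=
  ∀ a : ℝ, 0 < a → ∀ V : Set PM, MeasurableSet V → Q (frontier V) = 0 →
    Tendsto (fun n => w n * m n (MSet a ∩ normalise ⁻¹' V)) atTop
      (𝓝 (nuMeasure θ α {y | a < (y : ℝ)} * Q V))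

/-- Convergence of the tails of the largest modulus. -/
def RadiusConverges (m : ℕ → Measure PM) (w : ℕ → ℝ≥0∞) (θ α : ℝ) : Prop :=
  ∀ x : ℝ, 0 < x → Tendsto (fun n => w n * m n (MSet x)) atTop
    (𝓝 (nuMeasure θ α {y | x < (y : ℝ)}))

theorem forall_weaklyConverges_iff_jointConverges [∀ n, IsProbabilityMeasure (m n)]
    [IsProbabilityMeasure Q] (hθ : 0 < θ) (hα : 0 < α)
    (hw : ∀ n, w n ≠ ∞) (hA : RadiusConverges m w θ α) :
    (∀ x : ℝ, 0 < x → WeaklyConverges (fun n => ((m n)[|MSet x]).map normalise) Q) ↔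
      JointConverges m w Q θ α := by
  refine forall_congr' fun x => forall_congr' fun hx => ?_
  have hν := nuMeasure_setOf_lt_pos hθ hα hx
  have hprob : ∀ᶠ n in atTop, IsProbabilityMeasure (((m n)[|MSet x]).map normalise) := by
    filter_upwards [eventually_isProbabilityMeasure_cond (hA x hx) hν] with n hn
    exact Measure.isProbabilityMeasure_map measurable_normalise.aemeasurable
  rw [weaklyConverges_iff_null_frontier hprob]
  refine forall_congr' fun V => forall_congr' fun hV => forall_congr' fun _ => ?_
  rw [← tendsto_cond_iff (measurableSet_MSet x) hw (hA x hx) hν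
    (nuMeasure_setOf_lt_ne_top hθ.le hα hx) (normalise ⁻¹' V) (Q V) (measure_ne_top _ _)]
  refine tendsto_congr fun n => ?_
  rw [Measure.map_apply measurable_normalise hV]

/-- The interval `(a, b]` in the positive reals. -/
def posIoc (a b : ℝ) : Set (Ioi (0 : ℝ)) := {y | a < (y : ℝ) ∧ (y : ℝ) ≤ b}

/-- The half-open boxes `(a, b] × V` with `V` a continuity set. -/
def continuityBoxes (Q : Measure PM) : Set (Set (Ioi (0 : ℝ) × PM)) :=
  {s | ∃ (a b : ℝ) (V : Set PM), 0 < a ∧ MeasurableSet V ∧ Q (frontier V) = 0 ∧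
    s = posIoc a b ×ˢ V}

theorem isPiSystem_continuityBoxes (Q : Measure PM) : IsPiSystem (continuityBoxes Q) := by
  rintro _ ⟨a, b, V, ha, hV, hV0, rfl⟩ _ ⟨a', b', V', -, hV', hV0', rfl⟩ -
  refine ⟨max a a', min b b', V ∩ V', lt_max_of_lt_left ha, hV.inter hV', ?_, ?_⟩
  · refine measure_mono_null (frontier_inter_subset _ _) (measure_union_null ?_ ?_)
    · exact measure_mono_null inter_subset_left hV0
    · exact measure_mono_null inter_subset_right hV0'
  · rw [prod_inter_prod]
    congr 1
    ext y
    simp only [posIoc, mem_inter_iff, mem_ofPred_eq, max_lt_iff, le_min_iff]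
    tauto

theorem measurableSet_of_mem_continuityBoxes {s : Set (Ioi (0 : ℝ) × PM)}
    (hs : s ∈ continuityBoxes Q) : MeasurableSet s := by
  obtain ⟨a, b, V, -, hV, -, rfl⟩ := hs
  exact ((measurableSet_lt measurable_const measurable_subtype_coe).inter
    (measurableSet_le measurable_subtype_coe measurable_const)).prod hV

/-- Arbitrarily small balls around a point have `Q`-null frontier, so small boxes built on them fit
into any open set. -/
theorem exists_continuityBox_mem_nhds [IsFiniteMeasure Q] {u : Set (Ioi (0 : ℝ) × PM)}
    (hu : IsOpen u) {p : Ioi (0 : ℝ) × PM} (hp : p ∈ u) :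
    ∃ s ∈ continuityBoxes Q, s ∈ 𝓝 p ∧ s ⊆ u := by
  let _ : PseudoMetricSpace PM := TopologicalSpace.pseudoMetrizableSpacePseudoMetric PM
  obtain ⟨ε, hε, hεu⟩ := Metric.mem_nhds_iff.1 (hu.mem_nhds hp)
  obtain ⟨r, hr, hr0⟩ := exists_null_frontier_thickening Q {p.2} hε
  rw [Metric.thickening_singleton] at hr0
  have hy : (0 : ℝ) < p.1 := p.1.2
  -- The maximum with half of `p.1` keeps the left endpoint positive, as boxes require.
  have hb : posIoc (max ((p.1 : ℝ) / 2) (p.1 - ε / 2)) (p.1 + ε / 2)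
      ⊆ Metric.ball p.1 ε := by
    rintro y ⟨h1, h2⟩
    rw [max_lt_iff] at h1
    rw [Metric.mem_ball, Subtype.dist_eq, Real.dist_eq, abs_lt]
    constructor <;> linarith
  refine ⟨_, ⟨max ((p.1 : ℝ) / 2) (p.1 - ε / 2), p.1 + ε / 2, Metric.ball p.2 r,
    lt_max_of_lt_left (half_pos hy), Metric.isOpen_ball.measurableSet, hr0, rfl⟩, ?_, ?_⟩
  · refine prod_mem_nhds ?_ (Metric.ball_mem_nhds _ hr.1)
    have h1 : {y : Ioi (0 : ℝ) | max ((p.1 : ℝ) / 2) (p.1 - ε / 2) < (y : ℝ)} ∈ 𝓝 p.1 :=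
      (isOpen_lt continuous_const continuous_subtype_val).mem_nhds
        (max_lt (half_lt_self hy) (by linarith))
    have h2 : {y : Ioi (0 : ℝ) | (y : ℝ) < p.1 + ε / 2} ∈ 𝓝 p.1 :=
      (isOpen_lt continuous_subtype_val continuous_const).mem_nhds
        (show (p.1 : ℝ) < p.1 + ε / 2 by linarith)
    filter_upwards [h1, h2] with y hy1 hy2
    exact ⟨hy1, le_of_lt hy2⟩
  · refine (Set.prod_mono hb (Metric.ball_subset_ball hr.2.le)).trans ?_
    rwa [ball_prod_same]

theorem mem_MSet_iff_lt_radius {μ : PM} (h : μ ∈ finiteNonzero) {a : ℝ} (ha : 0 ≤ a) :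
    μ ∈ MSet a ↔ a < (radius μ : ℝ) := by
  rw [MSet_eq, mem_ofPred_eq, coe_radius h, ENNReal.ofReal_lt_iff_lt_toReal ha h.2.ne]

theorem MSet_subset_finiteNonzero_union {x : ℝ} :
    MSet x ⊆ finiteNonzero ∪ {μ | topModulus μ = ∞} := by
  intro μ hμ
  rw [MSet_eq] at hμ
  by_cases h : topModulus μ = ∞
  · exact Or.inr h
  · exact Or.inl ⟨bot_le.trans_lt hμ, lt_top_iff_ne_top.2 h⟩

/-- Joint convergence along a box. -/
theorem JointConverges.tendsto_box [∀ n, IsProbabilityMeasure (m n)]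
    [IsProbabilityMeasure Q] (hθ : 0 < θ) (hα : 0 < α)
    (hw : ∀ n, w n ≠ ∞) (hfin : ∀ n, m n {μ | topModulus μ = ∞} = 0)
    (h : JointConverges m w Q θ α) {a b : ℝ} (ha : 0 < a) (hab : a ≤ b) {V : Set PM}
    (hV : MeasurableSet V) (hV0 : Q (frontier V) = 0) :
    Tendsto (fun n => w n * m n ({μ | a < (radius μ : ℝ) ∧ (radius μ : ℝ) ≤ b ∧ normalise μ ∈ V}
      ∩ MSet a)) atTop
      (𝓝 (nuMeasure θ α (posIoc a b) * Q V)) := by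
  have hb := ha.trans_le hab
  have hνb := nuMeasure_setOf_lt_ne_top hθ.le hα hb
  have hset : posIoc a b = ({y | a < (y : ℝ)} : Set (Ioi (0 : ℝ))) \ {y | b < (y : ℝ)} := by
    ext y; simp [posIoc]
  have hsub : {y : Ioi (0 : ℝ) | b < (y : ℝ)} ⊆ {y | a < (y : ℝ)} := fun y hy => hab.trans_lt hy
  rw [hset, measure_sdiff hsub (measurableSet_setOf_lt_coe b).nullMeasurableSet hνb,
    ENNReal.sub_mul fun _ _ => measure_ne_top _ _]
  refine (ENNReal.Tendsto.sub (h a ha V hV hV0) (h b hb V hV hV0)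
    (Or.inr (ENNReal.mul_ne_top hνb (measure_ne_top _ _)))).congr fun n => ?_
  have hms : MeasurableSet (MSet b ∩ normalise ⁻¹' V) :=
    (measurableSet_MSet b).inter (measurable_normalise hV)
  rw [← ENNReal.mul_sub fun _ _ => hw n, ← measure_sdiff
    (inter_subset_inter_left _ (MSet_anti hab)) hms.nullMeasurableSet (measure_ne_top _ _)]
  congr 1
  refine measure_congr ?_
  -- Discarding infinite moduli avoids the default value of `radius`.
  have hae : ∀ᵐ μ ∂(m n), topModulus μ ≠ ∞ := by
    rw [ae_iff]; simpa using hfin n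
  filter_upwards [hae] with μ hμ
  refine propext ?_
  show (μ ∈ MSet a ∩ normalise ⁻¹' V ∧ μ ∉ MSet b ∩ normalise ⁻¹' V) ↔
    (_ ∧ _ ∧ _) ∧ μ ∈ MSet a
  by_cases hm : μ ∈ MSet a
  · have hf : μ ∈ finiteNonzero := (MSet_subset_finiteNonzero_union hm).resolve_right hμ
    have h1 := mem_MSet_iff_lt_radius hf ha.le
    have h2 := mem_MSet_iff_lt_radius hf hb.le
    simp only [mem_inter_iff, mem_preimage, h1, h2, not_and]
    have := h1.1 hm
    constructor
    · rintro ⟨⟨h3, h4⟩, h5⟩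
      exact ⟨⟨h3, not_lt.1 fun h6 => h5 h6 h4, h4⟩, h3⟩
    · rintro ⟨⟨h3, h4, h5⟩, -⟩
      exact ⟨⟨h3, h5⟩, fun h6 => absurd h6 h4.not_gt⟩
  · constructor
    · exact fun h => absurd h.1.1 hm
    · exact fun h => absurd h.2 hm

/-- Convergence on continuity sets of the canonical measure. -/
def SetsConverge (m : ℕ → Measure PM) (w : ℕ → ℝ≥0∞) (L : Measure PM) : Prop :=
  ∀ x : ℝ, 0 < x → ∀ M : Set PM, MeasurableSet M → M ⊆ M₀ → L (frontier M ∩ MSet x) = 0 →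
    Tendsto (fun n => w n * m n (MSet x ∩ M)) atTop (𝓝 (L (M ∩ MSet x)))

theorem map_scale_prod_cond [IsProbabilityMeasure Q] (hQ : Q MTildeᶜ = 0) (hθ : 0 < θ) (hα : 0 < α)
    {x : ℝ} {M : Set PM} (hM : MeasurableSet M) :
    (((nuMeasure θ α)[|{y | x < (y : ℝ)}]).prod Q).map (fun p => scale p.1 p.2) M
      = (nuMeasure θ α {y | x < (y : ℝ)})⁻¹ * lambdaMeasure θ α Q (M ∩ MSet x) := by
  have := sigmaFinite_nuMeasure hθ.le hα
  rw [Measure.map_apply measurable_scale_uncurry hM,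
    Measure.prod_apply (measurable_scale_uncurry hM), lambdaMeasure_inter_MSet hQ θ α x hM,
    ProbabilityTheory.cond, lintegral_smul_measure]
  rfl

/-- Conditionally on `MSet x`, the polar coordinates converge in law to the product of the
normalised restriction of `ν` and `Q`; applying `scale` recovers the point measure, with limit law
`λ` normalised on `MSet x`. -/
theorem JointConverges.setsConverge [∀ n, IsProbabilityMeasure (m n)]
    [IsProbabilityMeasure Q] (hQ : Q MTildeᶜ = 0) (hθ : 0 < θ)
    (hα : 0 < α) (hw : ∀ n, w n ≠ ∞) (hfin : ∀ n, m n {μ | topModulus μ = ∞} = 0)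
    (hA : RadiusConverges m w θ α) (h : JointConverges m w Q θ α) :
    SetsConverge m w (lambdaMeasure θ α Q) := by
  intro x hx M hM _ hM0
  have hν := nuMeasure_setOf_lt_pos hθ hα hx
  have hν' := nuMeasure_setOf_lt_ne_top hθ.le hα hx
  set I : Set (Ioi (0 : ℝ)) := {y | x < (y : ℝ)} with hI
  have hIm : MeasurableSet I := measurableSet_setOf_lt_coe x
  have hνI : IsProbabilityMeasure ((nuMeasure θ α)[|I]) :=
    cond_isProbabilityMeasure_of_finite hν.ne' hν'
  let Λ : ProbabilityMeasure (Ioi (0 : ℝ) × PM) := ⟨((nuMeasure θ α)[|I]).prod Q, inferInstance⟩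
  let lawn : ℕ → Measure (Ioi (0 : ℝ) × PM) := fun n =>
    ((m n)[|MSet x]).map fun μ => (radius μ, normalise μ)
  have hΨ : Measurable fun μ : PM => (radius μ, normalise μ) :=
    measurable_radius.prodMk measurable_normalise
  let Λs : ℕ → ProbabilityMeasure (Ioi (0 : ℝ) × PM) := fun n => toProbability (lawn n) Λ
  have hΛs : ∀ᶠ n in atTop, (Λs n : Measure (Ioi (0 : ℝ) × PM)) = lawn n := by
    filter_upwards [eventually_isProbabilityMeasure_cond (hA x hx) hν] with n hn
    have : IsProbabilityMeasure (lawn n) := Measure.isProbabilityMeasure_map hΨ.aemeasurable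
    exact coe_toProbability (lawn n) Λ
  have hlim : Tendsto Λs atTop (𝓝 Λ) := by
    refine (isPiSystem_continuityBoxes Q).tendsto_probabilityMeasure_of_tendsto_of_mem
      (fun s hs => measurableSet_of_mem_continuityBoxes hs)
      (fun u hu p hp => exists_continuityBox_mem_nhds hu hp) ?_
    intro s hs
    have hsm := measurableSet_of_mem_continuityBoxes hs
    obtain ⟨a, b, V, ha, hV, hV0, rfl⟩ := hs
    rw [← ENNReal.tendsto_coe]
    simp only [ProbabilityMeasure.ennreal_coeFn_eq_coeFn_toMeasure]
    have hx' : x ≤ max a x := le_max_right _ _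
    -- The left endpoint absorbs the conditioning on `y > x`; the right one is raised to at least
    -- the left, so that an empty box is covered as well.
    have hbox := h.tendsto_box hθ hα hw hfin (lt_max_of_lt_left ha : 0 < max a x)
      (le_max_right b (max a x)) hV hV0
    have hset : posIoc (max a x) (max b (max a x))
        = I ∩ posIoc a b := by
      ext y
      simp only [hI, posIoc, mem_inter_iff, mem_ofPred_eq, max_lt_iff, le_max_iff]
      constructor
      · rintro ⟨⟨h1, h2⟩, h3 | h3 | h3⟩
        · exact ⟨h2, h1, h3⟩
        · exact absurd h1 h3.not_gt
        · exact absurd h2 h3.not_gt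
      · rintro ⟨h2, h1, h3⟩
        exact ⟨⟨h1, h2⟩, Or.inl h3⟩
    have hval : (Λ : Measure (Ioi (0 : ℝ) × PM)) (posIoc a b ×ˢ V)
        = (nuMeasure θ α I)⁻¹ * (nuMeasure θ α (I ∩ posIoc a b) * Q V) := by
      show (((nuMeasure θ α)[|I]).prod Q) _ = _
      rw [Measure.prod_prod, cond_apply hIm, mul_assoc]
    have hq : (Λ : Measure (Ioi (0 : ℝ) × PM)) (posIoc a b ×ˢ V) ≠ ∞ :=
      measure_ne_top _ _
    have key := (tendsto_cond_iff (measurableSet_MSet x) hw (hA x hx) hν hν'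
      ((fun μ : PM => (radius μ, normalise μ)) ⁻¹' (posIoc a b ×ˢ V)) _ hq).2 ?_
    · refine key.congr' ?_
      filter_upwards [hΛs] with n hn
      rw [hn, Measure.map_apply hΨ hsm]
    · rw [hval, ← mul_assoc, ENNReal.mul_inv_cancel hν.ne' hν', one_mul, ← hset]
      refine hbox.congr fun n => ?_
      congr 1
      refine measure_congr ?_
      have hae : ∀ᵐ μ ∂(m n), topModulus μ ≠ ∞ := by
        rw [ae_iff]; simpa using hfin n
      filter_upwards [hae] with μ hμ
      refine propext ?_
      show (_ ∧ _ ∧ _) ∧ μ ∈ MSet (max a x) ↔ μ ∈ MSet x ∧ (_ ∧ _) ∧ _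
      by_cases hm : μ ∈ MSet x
      · have hf : μ ∈ finiteNonzero := (MSet_subset_finiteNonzero_union hm).resolve_right hμ
        have h1 := (mem_MSet_iff_lt_radius hf hx.le).1 hm
        have h2 := mem_MSet_iff_lt_radius hf (lt_max_of_lt_left ha : 0 < max a x).le
        have h3 := Set.ext_iff.1 hset (radius μ)
        simp only [mem_ofPred_eq, mem_inter_iff, hI, posIoc] at h3
        rw [h2]
        tauto
      · have : μ ∉ MSet (max a x) := fun h' => hm (MSet_anti hx' h')
        tauto
  have hmap := ProbabilityMeasure.tendsto_map_of_tendsto_of_continuous Λs Λ hlim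
    continuous_scale_uncurry
  -- The limit law sees only the part of the frontier inside `MSet x`, which is exactly what the
  -- hypothesis makes null.
  have hfront : ((Λ.map continuous_scale_uncurry.measurable.aemeasurable : ProbabilityMeasure PM) :
      Measure PM) (frontier M) = 0 := by
    show (((nuMeasure θ α)[|I]).prod Q).map (fun p => scale p.1 p.2) (frontier M) = 0
    rw [map_scale_prod_cond hQ hθ hα isClosed_frontier.measurableSet, hM0, mul_zero]
  have hconv := ProbabilityMeasure.tendsto_measure_of_null_frontier_of_tendsto' hmap hfront
  have hlimval : ((Λ.map continuous_scale_uncurry.measurable.aemeasurable : ProbabilityMeasure PM) :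
      Measure PM) M = (nuMeasure θ α I)⁻¹ * lambdaMeasure θ α Q (M ∩ MSet x) :=
    map_scale_prod_cond hQ hθ hα hM
  have hq : (nuMeasure θ α I)⁻¹ * lambdaMeasure θ α Q (M ∩ MSet x) ≠ ∞ := by
    rw [← hlimval]; exact measure_ne_top _ _
  rw [hlimval] at hconv
  have key := (tendsto_cond_iff (measurableSet_MSet x) hw (hA x hx) hν hν' M _ hq).1 ?_
  · rwa [← mul_assoc, ENNReal.mul_inv_cancel hν.ne' hν', one_mul] at key
  · refine hconv.congr' ?_
    filter_upwards [hΛs] with n hn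
    show ((Λs n : Measure (Ioi (0 : ℝ) × PM)).map fun p => scale p.1 p.2) M = _
    rw [hn, Measure.map_map measurable_scale_uncurry hΨ]
    have : ((fun p : Ioi (0 : ℝ) × PM => scale p.1 p.2) ∘ fun μ : PM => (radius μ, normalise μ))
        = id := funext scale_radius_normalise
    rw [this, Measure.map_id]

/-- The set to test is the preimage of `V` under `normalise`, cut down to an open set where
`normalise` is continuous. Within `MSet a` its frontier lies over `frontier V`, up to measures of
infinite modulus, which are `λ`-null. -/
theorem SetsConverge.jointConverges [IsProbabilityMeasure Q] (hQ : Q MTildeᶜ = 0)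
    (hfin : ∀ n, m n {μ | topModulus μ = ∞} = 0)
    (h : SetsConverge m w (lambdaMeasure θ α Q)) : JointConverges m w Q θ α := by
  intro a ha V hV hV0
  have hfm : MeasurableSet finiteNonzero := isOpen_finiteNonzero.measurableSet
  let O : Set PM := MSet a ∩ finiteNonzero
  have hO : IsOpen O := (isOpen_MSet a).inter isOpen_finiteNonzero
  let M : Set PM := O ∩ normalise ⁻¹' V
  have hM : MeasurableSet M := hO.measurableSet.inter (measurable_normalise hV)
  have hfr : frontier M ∩ MSet a ⊆
      {μ | topModulus μ = ∞} ∪ (finiteNonzero ∩ normalise ⁻¹' frontier V) := by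
    rintro μ ⟨hμ, hμa⟩
    rcases MSet_subset_finiteNonzero_union hμa with hf | hf
    · refine Or.inr ⟨hf, ?_⟩
      have hcont : ContinuousAt normalise μ :=
        continuousOn_normalise.continuousAt (isOpen_finiteNonzero.mem_nhds hf)
      have hOn : O ∈ 𝓝 μ := hO.mem_nhds ⟨hμa, hf⟩
      refine ⟨?_, fun hint => hμ.2 ?_⟩
      · rw [mem_closure_iff_nhds]
        intro U hU
        obtain ⟨κ, hκ1, hκ2⟩ := mem_closure_iff_nhds.1 hμ.1 _ (hcont hU)
        exact ⟨normalise κ, hκ1, hκ2.2⟩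
      · rw [mem_interior_iff_mem_nhds] at hint ⊢
        exact inter_mem hOn (hcont hint)
    · exact Or.inl hf
  have hnull : lambdaMeasure θ α Q (frontier M ∩ MSet a) = 0 := by
    refine measure_mono_null hfr (measure_union_null ?_ ?_)
    · exact lambdaMeasure_eq_zero hQ θ α
        (continuous_topModulus.measurable (measurableSet_singleton ∞))
        fun y μ hμ h => (scale_mem_finiteNonzero hμ y).2.ne h
    · rw [lambdaMeasure_apply hQ θ α
        (hfm.inter (measurable_normalise isClosed_frontier.measurableSet)),
        lintegral_eq_zero_of_ae_eq_zero]
      refine ae_of_all _ fun y => ?_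
      -- On `MTilde`, normalising undoes the dilation, so the condition no longer depends on `y`.
      refine measure_mono_null (t := frontier V ∪ MTildeᶜ) (fun μ hμ => ?_)
        (measure_union_null hV0 hQ)
      by_cases hμM : μ ∈ MTilde
      · have h1 : normalise (scale y μ) ∈ frontier V := hμ.2
        rw [normalise_scale hμM] at h1
        exact Or.inl h1
      · exact Or.inr hμM
  have hconv := h a ha M hM (fun μ hμ => hμ.1.1.1) hnull
  have hlim : lambdaMeasure θ α Q (M ∩ MSet a) = nuMeasure θ α {y | a < (y : ℝ)} * Q V := by
    rw [lambdaMeasure_inter_MSet hQ θ α a hM, mul_comm, ← setLIntegral_const]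
    refine setLIntegral_congr_fun (measurableSet_setOf_lt_coe a) fun y hy => ?_
    refine measure_congr ?_
    filter_upwards [mem_ae_iff.2 hQ] with μ hμ
    refine propext ?_
    show (scale y μ ∈ O ∧ normalise (scale y μ) ∈ V) ↔ μ ∈ V
    rw [normalise_scale hμ]
    exact and_iff_right ⟨(scale_mem_MSet hμ y a).2 hy, scale_mem_finiteNonzero hμ y⟩
  rw [hlim] at hconv
  refine hconv.congr fun n => ?_
  congr 1
  refine measure_congr ?_
  have hae : ∀ᵐ μ ∂(m n), topModulus μ ≠ ∞ := by
    rw [ae_iff]; simpa using hfin n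
  filter_upwards [hae] with μ hμ
  refine propext ?_
  show μ ∈ MSet a ∧ (μ ∈ MSet a ∧ μ ∈ finiteNonzero) ∧ normalise μ ∈ V ↔
    μ ∈ MSet a ∧ normalise μ ∈ V
  constructor
  · exact fun h' => ⟨h'.1, h'.2.2⟩
  · exact fun h' => ⟨h'.1, ⟨h'.1, (MSet_subset_finiteNonzero_union h'.1).resolve_right hμ⟩, h'.2⟩

end Convergence

/-! Finite point sums and blocks of the sequence. -/

section PointSum

variable (s : Finset ℕ) (x : ℕ → ℝ)

theorem measurableEmbedding_coe :
    MeasurableEmbedding (Subtype.val : PuncturedEReal → EReal) :=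
  MeasurableEmbedding.subtype_coe (measurableSet_singleton (0 : EReal)).compl

open Classical in
theorem pointSum_apply {B : Set PuncturedEReal} (hB : MeasurableSet B) :
    (pointSum s x).toMeasure B
      = ∑ j ∈ s, if (x j : EReal) ∈ (Subtype.val '' B : Set EReal) then 1 else 0 := by
  rw [pointSum, Measure.finsetSum_apply]
  refine Finset.sum_congr rfl fun j _ => ?_
  rw [measurableEmbedding_coe.comap_apply,
    Measure.dirac_apply' _ (measurableEmbedding_coe.measurableSet_image.2 hB)]
  simp [Set.indicator]

theorem pointSum_pos_iff {B : Set PuncturedEReal} (hB : MeasurableSet B) :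
    0 < (pointSum s x).toMeasure B ↔ ∃ j ∈ s, (x j : EReal) ∈ (Subtype.val '' B : Set EReal) := by
  classical
  rw [pointSum_apply s x hB, pos_iff_ne_zero, Ne, Finset.sum_eq_zero_iff]
  push Not
  refine exists_congr fun j => and_congr_right fun _ => ?_
  simp

theorem topModulus_pointSum :
    topModulus (pointSum s x) = s.sup fun j => ENNReal.ofReal |x j| := by
  refine eq_of_forall_lt_iff fun c => ?_
  rw [lt_topModulus_iff, pointSum_pos_iff s x (isOpen_setOf_lt_modulus c).measurableSet,
    Finset.lt_sup_iff]
  refine exists_congr fun j => and_congr_right fun _ => ?_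
  constructor
  · rintro ⟨t, ht, hte⟩
    have ht' : c < (t : EReal).abs := ht
    rwa [hte, EReal.abs_def] at ht'
  · intro h
    have hx : (x j : EReal) ≠ 0 := by
      intro h0
      have : x j = 0 := by exact_mod_cast h0
      simp [this] at h
    exact ⟨⟨x j, hx⟩, h, rfl⟩

theorem topModulus_pointSum_ne_top : topModulus (pointSum s x) ≠ ∞ := by
  rw [topModulus_pointSum]
  refine ((Finset.sup_lt_iff ENNReal.zero_lt_top).2 fun j _ => ENNReal.ofReal_lt_top).ne

theorem scale_pointSum (y : Ioi (0 : ℝ)) :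
    scale y (pointSum s x) = pointSum s fun j => (y : ℝ) * x j := by
  classical
  refine PointMeasure.ext_toMeasure (Measure.ext fun B hB => ?_)
  rw [scale_toMeasure_apply y _ hB, pointSum_apply _ _ hB,
    pointSum_apply _ _ ((continuous_dilate y).measurable hB)]
  refine Finset.sum_congr rfl fun j _ => ?_
  congr 1
  refine propext ⟨?_, ?_⟩
  · rintro ⟨t, ht, hte⟩
    refine ⟨dilate y t, ht, ?_⟩
    show ((y : ℝ) : EReal) * (t : EReal) = _
    rw [hte, EReal.coe_mul]
  · rintro ⟨u, hu, hue⟩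
    have hx : (x j : EReal) ≠ 0 := by
      intro h0
      have h1 : x j = 0 := by exact_mod_cast h0
      rw [h1, mul_zero] at hue
      exact u.2 (by simpa using hue)
    have hd : dilate y ⟨x j, hx⟩ = u := by
      refine Subtype.ext ?_
      show ((y : ℝ) : EReal) * (x j : EReal) = _
      rw [hue, EReal.coe_mul]
    exact ⟨⟨x j, hx⟩, by rw [mem_preimage, hd]; exact hu, rfl⟩

/-- Extending `f` by zero at the removed origin makes the integral a finite sum of measurable
functions of the `x j`, as `measurable_pointSum` needs. -/
theorem pointSum_integral {f : PuncturedEReal → ℝ≥0} (hf : Measurable f) :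
    (pointSum s x).integral f = ∑ j ∈ s,
      Function.extend Subtype.val (fun t => (f t : ℝ≥0∞)) 0 (x j : EReal) := by
  set F : EReal → ℝ≥0∞ := Function.extend Subtype.val (fun t => (f t : ℝ≥0∞)) 0 with hF
  have hFm : Measurable F :=
    measurableEmbedding_coe.measurable_extend hf.coe_nnreal_ennreal measurable_zero
  have hFe : ∀ t : PuncturedEReal, F t = f t := fun t =>
    Subtype.val_injective.extend_apply _ _ t
  have hF0 : F 0 = 0 := Function.extend_apply' _ _ _ fun ⟨t, ht⟩ => t.2 ht
  have hE : MeasurableSet {t : EReal | t ≠ 0} := (measurableSet_singleton (0 : EReal)).compl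
  show ∫⁻ t, (f t : ℝ≥0∞) ∂(∑ j ∈ s, (Measure.dirac (x j : EReal)).comap Subtype.val) = _
  rw [lintegral_finsetSum_measure]
  refine Finset.sum_congr rfl fun j _ => ?_
  have h1 : ∫⁻ t, (f t : ℝ≥0∞) ∂((Measure.dirac (x j : EReal)).comap Subtype.val)
      = ∫⁻ t : PuncturedEReal, F t ∂((Measure.dirac (x j : EReal)).comap Subtype.val) :=
    lintegral_congr fun t => (hFe t).symm
  refine h1.trans ((lintegral_subtype_comap hE F).trans ?_)
  rw [← lintegral_indicator hE, lintegral_dirac' _ (hFm.indicator hE)]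
  by_cases h : (x j : EReal) ≠ 0
  · exact indicator_of_mem (by exact h) _
  · rw [indicator_of_notMem (by exact h), not_not.1 h, hF0]

theorem measurable_pointSum {Y : Type*} [MeasurableSpace Y] {x : Y → ℕ → ℝ}
    (hx : ∀ j ∈ s, Measurable fun y => x y j) : Measurable fun y => pointSum s (x y) := by
  refine PointMeasure.measurable_of_integral fun f => ?_
  rw [funext fun y => pointSum_integral s (x y) (f := f) f.continuous.measurable]
  refine Finset.measurable_sum _ fun j hj => ?_
  exact (measurableEmbedding_coe.measurable_extend f.continuous.measurable.coe_nnreal_ennreal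
    measurable_zero).comp (measurable_coe_real_ereal.comp (hx j hj))

end PointSum

/-! ### Block laws and translation of the four conditions. -/

section Blocks

variable {Ω : Type*} {ξ : ℕ → Ω → ℝ} {a : ℕ → ℝ} {k : ℕ → ℕ}

/-- Reindexing exhibits every block as one fixed functional of a shifted sequence, the form in which
stationarity applies. -/
theorem blockN_eq_pointSum_range (n : ℕ) {i : ℕ} (hi : 1 ≤ i) (ω : Ω) :
    blockN ξ a k n i ω = pointSum (Finset.range (blockLength k n))
      fun j => ξ (j + 1 + (i - 1) * blockLength k n) ω / a n := by
  refine PointMeasure.ext_toMeasure ?_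
  have hir : i * blockLength k n = (i - 1) * blockLength k n + blockLength k n := by
    obtain ⟨l, rfl⟩ := Nat.exists_eq_add_of_le' hi
    simp [Nat.add_mul]
  show ∑ j ∈ Finset.Ioc ((i - 1) * blockLength k n) (i * blockLength k n),
      (Measure.dirac ((ξ j ω / a n : ℝ) : EReal)).comap Subtype.val = ∑ j ∈ Finset.range _,
      (Measure.dirac ((ξ (j + 1 + (i - 1) * blockLength k n) ω / a n : ℝ) : EReal)).comap Subtype.val
  rw [hir]
  generalize (i - 1) * blockLength k n = h
  symm
  refine Finset.sum_nbij' (fun j => j + 1 + h) (fun j => j - 1 - h) ?_ ?_ ?_ ?_ ?_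
  · intro j hj
    simp only [Finset.mem_range, Finset.mem_Ioc] at hj ⊢
    lia
  · intro j hj
    simp only [Finset.mem_range, Finset.mem_Ioc] at hj ⊢
    lia
  · intro j _
    lia
  · intro j hj
    simp only [Finset.mem_Ioc] at hj
    lia
  · intro j _
    rfl

theorem blockN_one (n : ℕ) (ω : Ω) :
    blockN ξ a k n 1 ω = pointSum (Finset.Icc 1 (blockLength k n)) fun j => ξ j ω / a n := by
  have : Finset.Ioc ((1 - 1) * blockLength k n) (1 * blockLength k n)
      = Finset.Icc 1 (blockLength k n) := by
    ext j
    simp only [Finset.mem_Ioc, Finset.mem_Icc]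
    lia
  rw [blockN, this]

theorem topModulus_blockN_one (n : ℕ) (ha : 0 < a n) (ω : Ω) :
    topModulus (blockN ξ a k n 1 ω) = ENNReal.ofReal (maxAbs ξ (blockLength k n) ω / a n) := by
  rw [blockN_one, topModulus_pointSum, maxAbs]
  let g : ℝ≥0 → ℝ≥0∞ := fun z => ENNReal.ofReal ((z : ℝ) / a n)
  have hg : Monotone g := fun z z' h => ENNReal.ofReal_le_ofReal (by gcongr)
  have h := Finset.apply_sup_eq_sup_comp_of_linearOrder g hg (by simp [g])
    (s := Finset.Icc 1 (blockLength k n)) (f := fun j => ‖ξ j ω‖₊)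
  show _ = g _
  rw [h]
  refine Finset.sup_congr rfl fun j _ => ?_
  show _ = ENNReal.ofReal (‖ξ j ω‖ / a n)
  rw [abs_div, abs_of_pos ha, Real.norm_eq_abs]

theorem blockN_one_mem_MSet_iff (n : ℕ) (ha : 0 < a n) (ω : Ω) {x : ℝ} (hx : 0 ≤ x) :
    blockN ξ a k n 1 ω ∈ MSet x ↔ a n * x < maxAbs ξ (blockLength k n) ω := by
  rw [MSet_eq, mem_ofPred_eq, topModulus_blockN_one n ha,
    ENNReal.ofReal_lt_ofReal_iff_of_nonneg hx, lt_div_iff₀ ha, mul_comm]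

theorem abs_le_maxAbs {r j : ℕ} (hj : j ∈ Finset.Icc 1 r) (ω : Ω) : |ξ j ω| ≤ maxAbs ξ r ω := by
  rw [maxAbs, ← Real.norm_eq_abs, ← coe_nnnorm, NNReal.coe_le_coe]
  exact Finset.le_sup (f := fun j => ‖ξ j ω‖₊) hj

theorem exists_abs_eq_maxAbs {r : ℕ} {ω : Ω} (h : 0 < maxAbs ξ r ω) :
    ∃ j ∈ Finset.Icc 1 r, |ξ j ω| = maxAbs ξ r ω := by
  have hne : (Finset.Icc 1 r).Nonempty := by
    by_contra hc
    rw [Finset.not_nonempty_iff_eq_empty] at hc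
    simp [maxAbs, hc] at h
  obtain ⟨j, hj, he⟩ := Finset.exists_mem_eq_sup _ hne fun j => ‖ξ j ω‖₊
  refine ⟨j, hj, ?_⟩
  rw [maxAbs, he, coe_nnnorm, Real.norm_eq_abs]

theorem cluster_mem_MTilde {n : ℕ} {ω : Ω} (h : 0 < maxAbs ξ (blockLength k n) ω) :
    cluster ξ k n ω ∈ MTilde := by
  constructor
  · have htop : ¬ ENNReal.ofReal 1 < topModulus (cluster ξ k n ω) := by
      rw [not_lt, cluster, topModulus_pointSum]
      refine Finset.sup_le fun j hj => ENNReal.ofReal_le_ofReal ?_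
      rw [abs_div, abs_of_pos h]
      exact div_le_one_of_le₀ (abs_le_maxAbs hj ω) h.le
    rw [lt_topModulus_iff] at htop
    exact nonpos_iff_eq_zero.1 (not_lt.1 htop)
  · have hm : MeasurableSet {t : PuncturedEReal | (t : EReal) = -1 ∨ (t : EReal) = 1} :=
      (measurable_subtype_coe (measurableSet_singleton (-1))).union
        (measurable_subtype_coe (measurableSet_singleton 1))
    rw [cluster, pointSum_pos_iff _ _ hm]
    obtain ⟨j, hj, he⟩ := exists_abs_eq_maxAbs h
    refine ⟨j, hj, ?_⟩
    rcases abs_choice (ξ j ω) with h1 | h1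
    · have h2 : ξ j ω / maxAbs ξ (blockLength k n) ω = 1 := by
        rw [← he, h1, div_self]
        rintro h0
        rw [h0, abs_zero] at he
        exact h.ne he
      rw [h2]
      exact ⟨⟨1, one_ne_zero⟩, Or.inr rfl, rfl⟩
    · have h2 : ξ j ω / maxAbs ξ (blockLength k n) ω = -1 := by
        have h3 : ξ j ω = -maxAbs ξ (blockLength k n) ω := by rw [← he, h1, neg_neg]
        rw [h3, neg_div, div_self h.ne']
      rw [h2]
      exact ⟨⟨-1, by simp⟩, Or.inl rfl, by simp⟩

/-- The block is the cluster dilated by the maximum over `a n`, and the cluster lies in `MTilde`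
because the maximum is attained. -/
theorem normalise_blockN_one {n : ℕ} (ha : 0 < a n) {ω : Ω}
    (h : 0 < maxAbs ξ (blockLength k n) ω) :
    normalise (blockN ξ a k n 1 ω) = cluster ξ k n ω := by
  let y : Ioi (0 : ℝ) := ⟨maxAbs ξ (blockLength k n) ω / a n, mem_Ioi.2 (div_pos h ha)⟩
  have hb : blockN ξ a k n 1 ω = scale y (cluster ξ k n ω) := by
    rw [blockN_one, cluster, scale_pointSum]
    congr 1
    funext j
    show _ = maxAbs ξ (blockLength k n) ω / a n * _
    field_simp
  rw [hb, normalise_scale (cluster_mem_MTilde h)]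

variable [MeasurableSpace Ω] {P : Measure Ω}

theorem measurable_blockN (hmeas : ∀ j, 1 ≤ j → Measurable (ξ j)) (n i : ℕ) :
    Measurable (blockN ξ a k n i) := by
  refine measurable_pointSum _ fun j hj => (hmeas j ?_).div_const _
  exact Nat.one_le_of_lt (Finset.mem_Ioc.1 hj).1

/-- By stationarity all blocks have the same law. -/
theorem map_blockN (hmeas : ∀ j, 1 ≤ j → Measurable (ξ j)) (hstat : IsStationarySeq P ξ) (n : ℕ)
    {i : ℕ} (hi : 1 ≤ i) : P.map (blockN ξ a k n i) = P.map (blockN ξ a k n 1) := by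
  let G : (ℕ → ℝ) → PM := fun z => pointSum (Finset.range (blockLength k n)) fun j => z j / a n
  have hG : Measurable G := measurable_pointSum _ fun j _ => (measurable_pi_apply j).div_const _
  have hshift : ∀ h : ℕ, Measurable fun ω (j : ℕ) => ξ (j + 1 + h) ω := fun h =>
    measurable_pi_iff.2 fun j => hmeas _ (by lia)
  have key : ∀ l : ℕ, 1 ≤ l →
      P.map (blockN ξ a k n l) = (P.map fun ω (j : ℕ) => ξ (j + 1) ω).map G := by
    intro l hl
    rw [← hstat ((l - 1) * blockLength k n), Measure.map_map hG (hshift _)]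
    congr 1
    funext ω
    exact blockN_eq_pointSum_range n hl ω
  rw [key i hi, key 1 le_rfl]

theorem sum_measure_blockN (hmeas : ∀ j, 1 ≤ j → Measurable (ξ j)) (hstat : IsStationarySeq P ξ)
    (n : ℕ) {S : Set PM} (hS : MeasurableSet S) :
    ∑ i ∈ Finset.Icc 1 (k n), P {ω | blockN ξ a k n i ω ∈ S}
      = (k n : ℝ≥0∞) * P.map (blockN ξ a k n 1) S := by
  have h : ∀ i ∈ Finset.Icc 1 (k n), P {ω | blockN ξ a k n i ω ∈ S}
      = P.map (blockN ξ a k n 1) S := by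
    intro i hi
    rw [← map_blockN hmeas hstat n (Finset.mem_Icc.1 hi).1,
      Measure.map_apply (measurable_blockN hmeas n i) hS]
    rfl
  rw [Finset.sum_congr rfl h]
  simp

/-- The conditioning event is that the first block lies in `MSet x`; there the maximum is positive,
so the cluster is the normalised block. -/
theorem map_cluster_cond (hmeas : ∀ j, 1 ≤ j → Measurable (ξ j)) (n : ℕ) (ha : 0 < a n) {x : ℝ}
    (hx : 0 < x) :
    (P[|{ω | a n * x < maxAbs ξ (blockLength k n) ω}]).map (cluster ξ k n)
      = ((P.map (blockN ξ a k n 1))[|MSet x]).map normalise := by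
  have hb := measurable_blockN (a := a) (k := k) hmeas n 1
  have hset : {ω | a n * x < maxAbs ξ (blockLength k n) ω} = blockN ξ a k n 1 ⁻¹' MSet x := by
    ext ω
    exact (blockN_one_mem_MSet_iff n ha ω hx.le).symm
  have hm : MeasurableSet {ω | a n * x < maxAbs ξ (blockLength k n) ω} := by
    rw [hset]
    exact hb (measurableSet_MSet x)
  have hae : cluster ξ k n =ᵐ[P[|{ω | a n * x < maxAbs ξ (blockLength k n) ω}]]
      normalise ∘ blockN ξ a k n 1 := by
    filter_upwards [ae_cond_mem hm] with ω hω
    exact (normalise_blockN_one ha ((mul_pos ha hx).trans hω)).symm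
  rw [Measure.map_congr hae, ← Measure.map_map measurable_normalise hb]
  congr 1
  rw [hset, ProbabilityTheory.cond, ProbabilityTheory.cond, Measure.map_smul,
    Measure.restrict_map hb (measurableSet_MSet x), Measure.map_apply hb (measurableSet_MSet x)]

theorem maximaCondition_iff [IsProbabilityMeasure P] (hmeas : ∀ j, 1 ≤ j → Measurable (ξ j))
    (ha : ∀ n, 0 < a n) {θ α : ℝ} (hθ : 0 ≤ θ) (hα : 0 < α) :
    MaximaCondition P ξ a k θ α ↔
      RadiusConverges (fun n => P.map (blockN ξ a k n 1)) (fun n => (k n : ℝ≥0∞)) θ α := by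
  refine forall_congr' fun x => forall_congr' fun hx => ?_
  rw [nuMeasure_setOf_lt hθ hα hx, ← ENNReal.tendsto_toReal_iff
    (fun n => ENNReal.mul_ne_top (ENNReal.natCast_ne_top _) ?_) ENNReal.ofReal_ne_top,
    ENNReal.toReal_ofReal (by positivity)]
  · refine tendsto_congr fun n => ?_
    rw [ENNReal.toReal_mul, ENNReal.toReal_natCast,
      Measure.map_apply (measurable_blockN hmeas n 1) (measurableSet_MSet x), Measure.real]
    congr 3
    ext ω
    exact (blockN_one_mem_MSet_iff n (ha n) ω hx.le).symm
  · rw [Measure.map_apply (measurable_blockN hmeas n 1) (measurableSet_MSet x)]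
    exact measure_ne_top _ _

theorem clusterCondition_iff (hmeas : ∀ j, 1 ≤ j → Measurable (ξ j)) (ha : ∀ n, 0 < a n)
    (Q : Measure PM) :
    ClusterCondition P ξ a k Q ↔ ∀ x : ℝ, 0 < x →
      WeaklyConverges (fun n => ((P.map (blockN ξ a k n 1))[|MSet x]).map normalise) Q := by
  refine forall_congr' fun x => forall_congr' fun hx => ?_
  have : (fun n => (P[|{ω | a n * x < maxAbs ξ (blockLength k n) ω}]).map (cluster ξ k n))
      = fun n => ((P.map (blockN ξ a k n 1))[|MSet x]).map normalise :=
    funext fun n => map_cluster_cond hmeas n (ha n) hx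
  rw [this]

theorem conditionA_iff (hmeas : ∀ j, 1 ≤ j → Measurable (ξ j)) (hstat : IsStationarySeq P ξ)
    {Q : Measure PM} [IsProbabilityMeasure Q] (hQ : Q MTildeᶜ = 0) (θ α : ℝ) :
    ConditionA P k (blockN ξ a k) (lambdaMeasure θ α Q) ∅ ↔
      RadiusConverges (fun n => P.map (blockN ξ a k n 1)) (fun n => (k n : ℝ≥0∞)) θ α := by
  refine forall_congr' fun x => forall_congr' fun hx => ?_
  simp only [mem_empty_iff_false, not_false_eq_true, forall_const]
  rw [lambdaMeasure_MSet hQ]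
  refine tendsto_congr fun n => ?_
  rw [← sum_measure_blockN hmeas hstat n (measurableSet_MSet x), MSet_eq]
  rfl

/-- The proviso that `MSet x` has positive mass always holds because `θ > 0`, and the sum consists
of `k n` equal terms. -/
theorem conditionB_iff (hmeas : ∀ j, 1 ≤ j → Measurable (ξ j)) (hstat : IsStationarySeq P ξ)
    {Q : Measure PM} [IsProbabilityMeasure Q] (hQ : Q MTildeᶜ = 0) {θ α : ℝ} (hθ : 0 < θ)
    (hα : 0 < α) :
    ConditionB P k (blockN ξ a k) (lambdaMeasure θ α Q) ∅ ↔
      SetsConverge (fun n => P.map (blockN ξ a k n 1)) (fun n => (k n : ℝ≥0∞))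
        (lambdaMeasure θ α Q) := by
  refine forall_congr' fun x => forall_congr' fun hx => ?_
  have hpos : 0 < lambdaMeasure θ α Q (MSet x) := by
    rw [lambdaMeasure_MSet hQ]
    exact nuMeasure_setOf_lt_pos hθ hα hx
  simp only [mem_empty_iff_false, not_false_eq_true, forall_const, hpos]
  refine forall_congr' fun M => forall_congr' fun hM => forall_congr' fun _ =>
    forall_congr' fun _ => ?_
  refine tendsto_congr fun n => ?_
  rw [← sum_measure_blockN hmeas hstat n ((measurableSet_MSet x).inter hM), MSet_eq]
  rfl

theorem map_blockN_infinite [IsProbabilityMeasure P] (hmeas : ∀ j, 1 ≤ j → Measurable (ξ j))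
    (n : ℕ) : P.map (blockN ξ a k n 1) {μ | topModulus μ = ∞} = 0 := by
  have hm : MeasurableSet {μ : PM | topModulus μ = ∞} :=
    continuous_topModulus.measurable (measurableSet_singleton ∞)
  rw [Measure.map_apply (measurable_blockN hmeas n 1) hm]
  have : blockN ξ a k n 1 ⁻¹' {μ | topModulus μ = ∞} = ∅ :=
    eq_empty_of_forall_notMem fun ω hω => topModulus_pointSum_ne_top _ _ hω
  rw [this, measure_empty]

end Blocks

end

/-! ### The main theorem. -/

theorem proposition3p2 {Ω : Type*} [MeasurableSpace Ω] (P : Measure Ω) [IsProbabilityMeasure P]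
    (ξ : ℕ → Ω → ℝ) (hmeas : ∀ j, 1 ≤ j → Measurable (ξ j))
    (hne : ∀ j, 1 ≤ j → ∀ ω, ξ j ω ≠ 0)
    (hstat : IsStationarySeq P ξ)
    (a : ℕ → ℝ) (ha : ∀ n, 0 < a n)
    (hnorm : Tendsto (fun n : ℕ => (n : ℝ) * P.real {ω | a n < |ξ 1 ω|}) atTop (𝓝 1))
    (α : ℝ) (hα : 0 < α) (hreg : RegularlyVaryingTails P (ξ 1) α)
    (k : ℕ → ℕ) (hAI : ConditionAI P (processN ξ a) k (blockN ξ a k))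
    (θ : ℝ) (hθ : 0 < θ) (hθ' : θ ≤ 1)
    (Q : Measure PM) [IsProbabilityMeasure Q] (hQ : Q MTildeᶜ = 0) :
    IsCanonicalMeasure (lambdaMeasure θ α Q) ∧
    (∀ x : ℝ, 0 < x →
      lambdaMeasure θ α Q (MSet x) = nuMeasure θ α {y | x < (y : ℝ)} ∧
      ∀ M : Set PM, MeasurableSet M →
        lambdaMeasure θ α Q (M ∩ MSet x)
          = ∫⁻ y in {y : Ioi (0 : ℝ) | x < (y : ℝ)}, kernelK Q y M ∂(nuMeasure θ α)) ∧
    (∀ R : Measure PM, IsInfDivLaw R (lambdaMeasure θ α Q) →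
      R {μ | 0 < μ.toMeasure {t | (t : EReal) = ⊤ ∨ (t : EReal) = ⊥}} = 0 ∧
      fixedAtomModuli R = ∅) ∧
    ((MaximaCondition P ξ a k θ α ∧ ClusterCondition P ξ a k Q) ↔
      (ConditionA P k (blockN ξ a k) (lambdaMeasure θ α Q) ∅ ∧
        ConditionB P k (blockN ξ a k) (lambdaMeasure θ α Q) ∅)) := by
  refine ⟨isCanonicalMeasure_lambdaMeasure hQ hθ.le hα, fun x _ => ⟨lambdaMeasure_MSet hQ θ α x,
    fun M hM => ?_⟩, fun R hR => ⟨?_, fixedAtomModuli_eq_empty hQ hθ.le hα hR⟩, ?_⟩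
  · rw [lambdaMeasure_inter_MSet hQ θ α x hM]
    exact lintegral_congr fun y => (kernelK_apply hQ y hM).symm
  · rw [setOf_top_or_bot_eq]
    exact hR.measure_pos_eq_zero (PuncturedEReal.isCompact_setOf_le_modulus ENNReal.zero_lt_top)
      (lambdaMeasure_charging_infinity hQ θ α)
  · rw [maximaCondition_iff hmeas ha hθ.le hα, clusterCondition_iff hmeas ha,
      conditionA_iff hmeas hstat hQ, conditionB_iff hmeas hstat hQ hθ hα]
    have hprob : ∀ n, IsProbabilityMeasure (P.map (blockN ξ a k n 1)) := fun n =>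
      Measure.isProbabilityMeasure_map (measurable_blockN hmeas n 1).aemeasurable
    have hw : ∀ n, (k n : ℝ≥0∞) ≠ ∞ := fun n => ENNReal.natCast_ne_top _
    have hfin := map_blockN_infinite (P := P) (a := a) (k := k) hmeas
    -- The first conditions coincide, and their common content supplies the normalising limit for
    -- comparing the second ones.
    refine and_congr_right fun hA => ?_
    rw [forall_weaklyConverges_iff_jointConverges hθ hα hw hA]
    exact ⟨fun h => h.setsConverge hQ hθ hα hw hfin hA, fun h => h.jointConverges hQ hfin⟩
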